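/- A cyclic polygon $P=P(V,E)$ consists of a finite set $V$ of points on a circle in the plane and a set $E\subset V\times V$ of directed edges such that every vertex has indegree $1$ and outdegree $1$, and $u,v,w$ are in anti-clockwise order whenever $uv,vw\in E$. Write $v^-v$ and $vv^+$ for the edges of $E$ entering and leaving $v$. The length of an edge $uv$ is the number of vertices of $V$ on the arc running anti-clockwise from $u$ (excluded) to $v$ (included). For $k\ge 1$, a $k$-star is a cyclic polygon with $2k+1$ vertices all of whose edges have length $k$; a star is a $k$-star for some $k\ge 1$. For $k\ge 1$ and $n\ge 2k+1$, $P_n^k$ denotes a cyclic polygon with $n$ vertices all of whose edges have length $k$. A diagonal of $P$ is an undirected segment $\overline{uv}$ with $u,v\in V$ that splits both angles $\angle u^-uu^+$ and $\angle v^-vv^+$ into two smaller angles. For a set $D$ of diagonals let $\tilde D$ be the set of all directed edges $uv$ and $vu$ with $\overline{uv}\in D$. For $uv\in E\cup\tilde D$ let $f_{\rm next}(uv)$ be the edge $vw\in E\cup\tilde D$ such that $u,v,w$ are in anti-clockwise order and no diagonal of $D$ splits $\angle uvw$. Then $f_{\rm next}$ is a bijection of $E\cup\tilde D$, and its orbits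 form the cycle decomposition of $P$ with respect to $D$. This is a star decomposition of $P$ with respect to $D$ if every cycle (with its endvertices as vertex set) is a star, and a $k$-star decomposition, or $k$-triangulation, if every cycle is a $k$-star. A star decomposition with respect to $D$ is maximal if there is no star decomposition of $P$ with respect to any set of diagonals $D'\supsetneq D$. **Proposition.** Let $k\ge 1$ and $n\ge 2k+1$. Every maximal star decomposition of $P_n^k$ is a $k$-star decomposition. -/

import Mathlib

/-! Cyclic polygons, stars and star decompositions.  The plane is `ℂ`; a directed edge `uv` is the
pair `(u, v)`, and an undirected segment is the unordered pair `s(u, v)`. -/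

namespace StarDecomp

/-- The points `u, v, w` are in anti-clockwise order: the signed area of the triangle `u v w` is
positive (so the points are in particular distinct). -/
def CCW (u v w : ℂ) : Prop :=
  0 < (v.re - u.re) * (w.im - u.im) - (v.im - u.im) * (w.re - u.re)

/-- `P(V, E)` is a cyclic polygon: `V` is a finite set of points on a circle, every vertex has
outdegree and indegree `1`, and consecutive edges `uv`, `vw` turn anti-clockwise. -/
structure IsCyclicPolygon (V : Set ℂ) (E : Set (ℂ × ℂ)) : Prop where
  finite : V.Finite
  circle : ∃ (c : ℂ) (R : ℝ), 0 < R ∧ V ⊆ Metric.sphere c R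
  edges : ∀ e ∈ E, e.1 ∈ V ∧ e.2 ∈ V
  outdegree : ∀ v ∈ V, ∃! w, (v, w) ∈ E
  indegree : ∀ v ∈ V, ∃! u, (u, v) ∈ E
  ccw : ∀ u v w, (u, v) ∈ E → (v, w) ∈ E → CCW u v w

/-- The length of `uv` with respect to `V`: the number of vertices on the arc that runs
anti-clockwise from `u` (excluded) to `v` (included). -/
noncomputable def edgeLength (V : Set ℂ) (u v : ℂ) : ℕ :=
  Set.ncard {x ∈ V | CCW u x v ∨ x = v}

/-- A `k`-star: a cyclic polygon with `2k+1` vertices all of whose edges have length `k`. -/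
structure IsKStar (k : ℕ) (V : Set ℂ) (E : Set (ℂ × ℂ)) : Prop where
  pos : 0 < k
  polygon : IsCyclicPolygon V E
  card : V.ncard = 2 * k + 1
  length : ∀ e ∈ E, edgeLength V e.1 e.2 = k

/-- `P(V, E)` is a polygon `P_n^k` (with `k ≥ 1` and `2k+1 ≤ n`): a cyclic polygon with `n` vertices
all of whose edges have length `k`. -/
structure IsP (n k : ℕ) (V : Set ℂ) (E : Set (ℂ × ℂ)) : Prop where
  pos : 0 < k
  le : 2 * k + 1 ≤ n
  polygon : IsCyclicPolygon V E
  card : V.ncard = n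
  length : ∀ e ∈ E, edgeLength V e.1 e.2 = k

/-- For `u, v, w` in anti-clockwise order, the ray from `v` to `x` lies strictly inside the convex
angle `∠ u v w`, so that the segment `vx` splits it into `∠ u v x` and `∠ x v w`. -/
def Splits (u v w x : ℂ) : Prop := CCW v w x ∧ CCW v x u

/-- `u` and `v` are linkable in `P(V, E)`: the segment `uv` splits both the angle `∠ u⁻ u u⁺` and
the angle `∠ v⁻ v v⁺`. -/
def Linkable (V : Set ℂ) (E : Set (ℂ × ℂ)) (u v : ℂ) : Prop :=
  u ∈ V ∧ v ∈ V ∧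
  (∃ a b, (a, u) ∈ E ∧ (u, b) ∈ E ∧ Splits a u b v) ∧
  (∃ a b, (a, v) ∈ E ∧ (v, b) ∈ E ∧ Splits a v b u)

/-- `D` is a set of diagonals of `P(V, E)`. -/
def IsDiagonalSet (V : Set ℂ) (E : Set (ℂ × ℂ)) (D : Set (Sym2 ℂ)) : Prop :=
  ∀ u v, s(u, v) ∈ D → Linkable V E u v

/-- The edge set `E ∪ D̃` of the subdivided cyclic polygon `P(V, E, D)`. -/
def subdividedEdges (E : Set (ℂ × ℂ)) (D : Set (Sym2 ℂ)) : Set (ℂ × ℂ) :=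
  E ∪ {e | s(e.1, e.2) ∈ D}

/-- `f = f_next(e)`: the edge `f = vw` of `E ∪ D̃` that follows `e = uv`, where `u, v, w` are in
anti-clockwise order and no diagonal of `D` splits `∠ u v w`. -/
def IsNext (E : Set (ℂ × ℂ)) (D : Set (Sym2 ℂ)) (e f : ℂ × ℂ) : Prop :=
  e ∈ subdividedEdges E D ∧ f ∈ subdividedEdges E D ∧ e.2 = f.1 ∧ CCW e.1 e.2 f.2 ∧
  ∀ x, s(e.2, x) ∈ D → ¬ Splits e.1 e.2 f.2 x

/-- The edge set `{e, f_next(e), f_next²(e), …}` of the cycle through `e` in the cycle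
decomposition of `P(V, E)` with respect to `D`. -/
def cycle (E : Set (ℂ × ℂ)) (D : Set (Sym2 ℂ)) (e : ℂ × ℂ) : Set (ℂ × ℂ) :=
  {f | Relation.ReflTransGen (IsNext E D) e f}

/-- The set of endvertices of a set of edges. -/
def verts (C : Set (ℂ × ℂ)) : Set ℂ := {v | ∃ e ∈ C, v = e.1 ∨ v = e.2}

/-- The cycle decomposition of `P(V, E)` with respect to the set of diagonals `D` is a star
decomposition: each of its cycles is a star. -/
def IsStarDecomposition (V : Set ℂ) (E : Set (ℂ × ℂ)) (D : Set (Sym2 ℂ)) : Prop :=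
  IsDiagonalSet V E D ∧
  ∀ e ∈ subdividedEdges E D, ∃ k, IsKStar k (verts (cycle E D e)) (cycle E D e)

/-- The cycle decomposition of `P(V, E)` with respect to the set of diagonals `D` is a `k`-star
decomposition (a `k`-triangulation): each of its cycles is a `k`-star. -/
def IsKStarDecomposition (k : ℕ) (V : Set ℂ) (E : Set (ℂ × ℂ)) (D : Set (Sym2 ℂ)) : Prop :=
  IsDiagonalSet V E D ∧
  ∀ e ∈ subdividedEdges E D, IsKStar k (verts (cycle E D e)) (cycle E D e)

/-- The star decomposition with respect to `D` is maximal: there is none with respect to a proper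
superset of `D`. -/
def IsMaximalStarDecomposition (V : Set ℂ) (E : Set (ℂ × ℂ)) (D : Set (Sym2 ℂ)) : Prop :=
  IsStarDecomposition V E D ∧ ∀ D', D ⊂ D' → ¬ IsStarDecomposition V E D'

end StarDecomp

/-!
A star decomposition of `P_n^k` is read as a system of closed curves, and maximality becomes the
statement that no two of these curves cross more than once.

Label the vertices clockwise by `ZMod n` (`exists_isLabelling`).  Then the edges are `(i, i - k)`, the
diagonals are the chords `ab` with `k < b - a < n - k`, and the chords `ab` with fixed `a + b = s` are
parallel in the regular `n`-gon, so that `s` serves as a direction.  Let a chord rotate about its end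
`v`, and whenever its direction makes it an edge or a diagonal in use, let the rotation continue about
the other end (`turn`).  The successive centres of rotation follow `f_next`, and a cycle is a star if
and only if the rotation closes up after exactly a half turn, that is when `s` has run once through
`ZMod n` (`IsP.time_of_star`, `IsP.isStarDecomposition`).  Thus star decompositions correspond to sets
of diagonals for which every admissible position lies on a closed trajectory `ZMod n → ZMod n`
(`Covered`).  There are `n - 2k` admissible positions in each direction (`card_act`), hence `n - 2k`
trajectories, and an `m`-star gives one that moves `2m + 1` times and stays `n - 2m - 1` times.

Where a trajectory stays at `v` although it passes the diagonal `vw`, it crosses the trajectory that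
stays at `w`.  A half turn reverses the order of parallel chords, so any two trajectories cross
(`IsTraj.exists_cross`).  If two trajectories crossed twice, the two diagonals at the crossings could
be added: the trajectories would just exchange their parts between the crossings and still close up
(`Covered.addChord₂`), which contradicts maximality.  So each trajectory crosses each of the
`n - 2k - 1` others exactly once, and `n - 2m - 1 = n - 2k - 1` (`IsTraj.card_move`).
-/

namespace StarDecomp

/-! ### Arithmetic in `ZMod n` -/

/-- The representative of `z` in `[0, n)`, in a form suited to linear arithmetic. -/
lemma val_cases {n : ℕ} [NeZero n] (a : ZMod n) (z : ℤ) (h : a = z) (h1 : -2 * (n : ℤ) ≤ z)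
    (h2 : z < 2 * n) : (a.val : ℤ) = z ∨ (a.val : ℤ) = z + n ∨ (a.val : ℤ) = z - n ∨
      (a.val : ℤ) = z + 2 * n := by
  have hlt := ZMod.val_lt a
  have e : (((a.val : ℤ) - z : ℤ) : ZMod n) = 0 := by
    push_cast
    rw [ZMod.natCast_zmod_val, h, sub_self]
  rw [ZMod.intCast_zmod_eq_zero_iff_dvd] at e
  obtain ⟨q, hq⟩ := e
  have hn : (0 : ℤ) < n := by have := NeZero.pos n; omega
  have q1 : q < 3 := by
    by_contra hh
    have : (n : ℤ) * 3 ≤ n * q := by gcongr; omega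
    omega
  have q2 : -2 < q := by
    by_contra hh
    have : (n : ℤ) * q ≤ n * (-2) := by gcongr; omega
    omega
  interval_cases q <;> omega

lemma val_sub_cases {n : ℕ} [NeZero n] (a b : ZMod n) :
    (a - b).val + b.val = a.val ∨ (a - b).val + b.val = a.val + n := by
  have ha := ZMod.val_lt a
  have hb := ZMod.val_lt b
  have hab := ZMod.val_lt (a - b)
  have := val_cases (a - b) ((a.val : ℤ) - b.val) (by simp) (by omega) (by omega)
  omega

lemma val_pos_iff {n : ℕ} [NeZero n] (a : ZMod n) : 0 < a.val ↔ a ≠ 0 := by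
  rw [Nat.pos_iff_ne_zero, Ne, ZMod.val_eq_zero]

lemma val_neg_add_val {n : ℕ} [NeZero n] {a b : ZMod n} (h : a ≠ b) :
    (a - b).val + (b - a).val = n := by
  have h1 := (val_pos_iff (a - b)).2 (sub_ne_zero.2 h)
  have h2 := (val_pos_iff (b - a)).2 (sub_ne_zero.2 h.symm)
  have h3 := ZMod.val_lt (a - b)
  have h4 := ZMod.val_lt (b - a)
  rcases val_sub_cases a b with h | h <;> rcases val_sub_cases b a with h' | h' <;> omega

/-! ### Trajectories of a rotating chord -/

variable {n : ℕ}

/-- The chord `vw` is an edge of `P_n^k` or a diagonal in `R` (in either direction). -/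
def Ed (k : ℕ) (R : ZMod n → ZMod n → Prop) (v w : ZMod n) : Prop :=
  R v w ∨ w = v + k ∨ v = w + k

open Classical in
/-- The effect of the chord direction `s` on a point at vertex `v`: if the chord from `v` in that
direction, which ends at `s - v`, is an edge or a diagonal, the point moves along it. -/
noncomputable def turn (k : ℕ) (R : ZMod n → ZMod n → Prop) (s v : ZMod n) : ZMod n :=
  if Ed k R v (s - v) then s - v else v

/-- Just after the direction `s`, the rotating chord through `v` lies in the angle of `P_n^k` at
`v`. -/
def Act (k : ℕ) (s v : ZMod n) : Prop := k ≤ (s - 2 * v).val ∧ (s - 2 * v).val + k < n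

/-- `R` is a set of diagonals of `P_n^k`, viewed as a symmetric relation on the vertices. -/
structure IsDiagRel (k : ℕ) (R : ZMod n → ZMod n → Prop) : Prop where
  symm : ∀ v w, R v w → R w v
  lo : ∀ v w, R v w → k < (w - v).val
  hi : ∀ v w, R v w → (w - v).val + k < n

/-- A closed trajectory: while the chord direction makes one half turn, which is a full turn of the
index `s`, the point `f s` traverses a closed polygon in the subdivided polygon. -/
def IsTraj (k : ℕ) (R : ZMod n → ZMod n → Prop) (f : ZMod n → ZMod n) : Prop :=
  ∀ s, Act k s (f s) ∧ f (s + 1) = turn k R (s + 1) (f s)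

/-- Every admissible position lies on a closed trajectory. -/
def Covered (k : ℕ) (R : ZMod n → ZMod n → Prop) : Prop :=
  ∀ s v, Act k s v → ∃ f, IsTraj k R f ∧ f s = v

lemma Ed.symm {k : ℕ} {R : ZMod n → ZMod n → Prop} (hR : IsDiagRel k R) {v w : ZMod n}
    (h : Ed k R v w) : Ed k R w v := by
  rcases h with h | h | h
  · exact Or.inl (hR.symm _ _ h)
  · exact Or.inr (Or.inr h)
  · exact Or.inr (Or.inl h)

lemma turn_turn {k : ℕ} {R : ZMod n → ZMod n → Prop} (hR : IsDiagRel k R) (s v : ZMod n) :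
    turn k R s (turn k R s v) = v := by
  by_cases h : Ed k R v (s - v)
  · have h1 : turn k R s v = s - v := if_pos h
    have h2 : Ed k R (s - v) (s - (s - v)) := by rw [sub_sub_cancel]; exact h.symm hR
    rw [h1, turn, if_pos h2, sub_sub_cancel]
  · have h1 : turn k R s v = v := if_neg h
    rw [h1, h1]

/-- The next chord reached by an admissible position is an edge or lies in the angle of
`P_n^k`. -/
lemma val_succ_of_act [NeZero n] {k : ℕ} {s v : ZMod n} (hk : 0 < k) (h : Act k s v) :
    (s + 1 - v - v).val = (s - 2 * v).val + 1 := by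
  obtain ⟨h1, h2⟩ := h
  have h3 := val_cases (s + 1 - v - v) ((s - 2 * v).val + 1 : ℤ)
    (by push_cast; rw [ZMod.natCast_zmod_val]; ring) (by omega) (by omega)
  have h4 := ZMod.val_lt (s + 1 - v - v)
  omega

lemma natCast_val_eq [NeZero n] {k : ℕ} (hn : k < n) {a b : ZMod n} :
    (a - b).val = k ↔ a = b + k := by
  constructor
  · rintro rfl
    simp
  · rintro rfl
    rw [add_sub_cancel_left, ZMod.val_natCast_of_lt hn]

lemma ne_of_act [NeZero n] {k : ℕ} {s v : ZMod n} (hk : 0 < k) (h : Act k s v) :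
    s + 1 - v ≠ v := by
  intro hh
  have := val_succ_of_act hk h
  rw [hh, sub_self, ZMod.val_zero] at this
  omega

lemma Act.turn [NeZero n] {k : ℕ} {R : ZMod n → ZMod n → Prop} (hk : 0 < k) (hn : 2 * k + 1 ≤ n)
    {s v : ZMod n} (h : Act k s v) : Act k (s + 1) (turn k R (s + 1) v) := by
  have h1 := val_succ_of_act hk h
  have hne := ne_of_act hk h
  have h4 := val_neg_add_val hne
  obtain ⟨h2, h3⟩ := h
  unfold StarDecomp.turn
  split_ifs with hE
  · rw [Act, show s + 1 - 2 * (s + 1 - v) = v - (s + 1 - v) by ring]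
    omega
  · rw [Act, show s + 1 - 2 * v = s + 1 - v - v by ring]
    refine ⟨by omega, ?_⟩
    by_contra hc
    refine hE (Or.inr (Or.inr ?_))
    rw [← natCast_val_eq (by omega)]
    omega

lemma IsTraj.stay_or_move {k : ℕ} {R : ZMod n → ZMod n → Prop} {f : ZMod n → ZMod n}
    (hf : IsTraj k R f) (s : ZMod n) :
    (Ed k R (f s) (s + 1 - f s) ∧ f (s + 1) = s + 1 - f s) ∨
      (¬ Ed k R (f s) (s + 1 - f s) ∧ f (s + 1) = f s) := by
  rw [(hf s).2, turn]
  split_ifs with h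
  · exact Or.inl ⟨h, rfl⟩
  · exact Or.inr ⟨h, rfl⟩

/-- Trajectories through a common position agree. -/
lemma IsTraj.eq_of_eq [NeZero n] {k : ℕ} {R : ZMod n → ZMod n → Prop} {f g : ZMod n → ZMod n}
    (hf : IsTraj k R f) (hg : IsTraj k R g) {s : ZMod n} (h : f s = g s) : f = g := by
  have key : ∀ i : ℕ, f (s + i) = g (s + i) := by
    intro i
    induction i with
    | zero => simpa using h
    | succ i ih =>
      have h1 := (hf (s + i)).2
      have h2 := (hg (s + i)).2
      rw [ih, ← h2] at h1
      push_cast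
      rw [← add_assoc, h1]
  funext t
  have := key (t - s).val
  simpa using this

/-- The number of admissible positions is the same in all directions; `s = -1` is convenient, since
`-1 - 2v` then needs only two lifts. -/
lemma card_act [NeZero n] {k : ℕ} (hk : 0 < k) (hn : 2 * k + 1 ≤ n)
    [DecidablePred (Act (n := n) k (-1))] :
    (Finset.univ.filter (Act (n := n) k (-1))).card = n - 2 * k := by
  have hm : (Finset.univ.filter (Act (n := n) k (-1))).card =
      (Finset.Icc ((k + 1) / 2) ((n - 1 - k) / 2) ∪
        Finset.Icc ((n + k + 1) / 2) ((2 * n - 1 - k) / 2)).card := by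
    refine Finset.card_bij (fun v _ => v.val) ?_ (fun a _ b _ h => ZMod.val_injective n h) ?_
    · intro v hv
      rw [Finset.mem_filter] at hv
      obtain ⟨-, h1, h2⟩ := hv
      have h3 := ZMod.val_lt v
      have h5 := ZMod.val_lt (-1 - 2 * v)
      have h4 := val_cases (-1 - 2 * v) (-1 - 2 * v.val + n : ℤ) (by simp) (by omega) (by omega)
      simp only [Finset.mem_union, Finset.mem_Icc]
      omega
    · intro b hb
      simp only [Finset.mem_union, Finset.mem_Icc] at hb
      refine ⟨(b : ZMod n), ?_, ZMod.val_natCast_of_lt (by omega)⟩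
      have h5 := ZMod.val_lt (-1 - 2 * (b : ZMod n))
      have h4 := val_cases (-1 - 2 * (b : ZMod n)) (-1 - 2 * b + n : ℤ) (by simp) (by omega)
        (by omega)
      rw [Finset.mem_filter]
      refine ⟨Finset.mem_univ _, ?_⟩
      rw [Act]
      omega
  rw [hm, Finset.card_union_of_disjoint, Nat.card_Icc, Nat.card_Icc]
  · obtain ⟨q, rfl | rfl⟩ := Nat.even_or_odd' n <;> obtain ⟨r, rfl | rfl⟩ := Nat.even_or_odd' k <;>
      omega
  · rw [Finset.disjoint_left]
    intro a ha hb
    rw [Finset.mem_Icc] at ha hb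
    omega

/-! ### Any two trajectories cross -/

/-- On the regular `n`-gon, the chord through vertex `v` in the direction `t + 1/2` is at signed
distance proportional to `cos (π (t + 1/2 - 2v) / n)` from the centre.  This decreases with the
distance of `t + 1/2 - 2v` to `0` modulo `2n`, whose integral part is the height used to order
parallel chords.  The cases cover `0 ≤ t ≤ n` and `0 ≤ v < n`. -/
def height (n t v : ℤ) : ℤ :=
  if t - 2 * v < -n then t - 2 * v + 2 * n
  else if t - 2 * v < 0 then -1 - (t - 2 * v)
  else if t - 2 * v < n then t - 2 * v else n - 1

lemma height_inj {n t v w : ℤ} (htn : t ≤ n) (hv : 0 ≤ v) (hvn : v < n) (hw : 0 ≤ w)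
    (hwn : w < n) (h : height n t v = height n t w) : v = w := by
  unfold height at h
  split_ifs at h <;> omega

lemma height_reverse {n v : ℤ} (hv : 0 ≤ v) (hvn : v < n) :
    height n n v = n - 1 - height n 0 v := by
  unfold height
  split_ifs <;> omega

/-- In one step, two admissible positions exchange their order only if both of them stay and they are
the ends of one chord in the new direction.  Here `y` and `z` are the residues of `t - 2v` and
`t - 2w` modulo `n`, and `v'` and `w'` are the next positions. -/
lemma height_step {k : ℕ} {n t v w v' w' : ℤ} (hk : 0 < k) (ht : 0 ≤ t) (htn : t < n)
    (hv : 0 ≤ v) (hvn : v < n) (hw : 0 ≤ w) (hwn : w < n) (hv' : 0 ≤ v') (hvn' : v' < n)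
    (hw' : 0 ≤ w') (hwn' : w' < n)
    {y z : ℤ} (hy : y = t - 2 * v ∨ y = t - 2 * v + n ∨ y = t - 2 * v - n ∨ y = t - 2 * v + 2 * n)
    (hz : z = t - 2 * w ∨ z = t - 2 * w + n ∨ z = t - 2 * w - n ∨ z = t - 2 * w + 2 * n)
    (hy1 : k ≤ y) (hy2 : y + k < n) (hz1 : k ≤ z) (hz2 : z + k < n)
    (mv : v' = v ∨ v' = t + 1 - v ∨ v' = t + 1 - v + n)
    (mw : w' = w ∨ w' = t + 1 - w ∨ w' = t + 1 - w + n) (hne : v' ≠ w')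
    (hcr : v' = v → w' = w → v + w ≠ t + 1 ∧ v + w ≠ t + 1 + n)
    (h : height n t v < height n t w) : height n (t + 1) v' < height n (t + 1) w' := by
  have hne' : height n (t + 1) v' ≠ height n (t + 1) w' := fun hh =>
    hne (height_inj (by omega) hv' hvn' hw' hwn' hh)
  -- A chord that stays changes its height by `1`, in a sense that depends on the end at which it is
  -- centred; a chord that changes its centre keeps its height.
  have stay : ∀ v y : ℤ, 0 ≤ v → v < n →
      (y = t - 2 * v ∨ y = t - 2 * v + n ∨ y = t - 2 * v - n ∨ y = t - 2 * v + 2 * n) →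
      k ≤ y → y + k < n →
      (height n (t + 1) v = height n t v + 1 ∧
        (height n t v = t - 2 * v ∨ height n t v = t - 2 * v + 2 * n)) ∨
      (height n (t + 1) v = height n t v - 1 ∧ height n t v = -1 - (t - 2 * v)) := by
    intro v y _ _ hy _ _
    unfold height
    split_ifs <;> omega
  have move : ∀ v v' y : ℤ, 0 ≤ v → v < n → 0 ≤ v' → v' < n →
      (y = t - 2 * v ∨ y = t - 2 * v + n ∨ y = t - 2 * v - n ∨ y = t - 2 * v + 2 * n) →
      k ≤ y → y + k < n → (v' = t + 1 - v ∨ v' = t + 1 - v + n) →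
      height n (t + 1) v' = height n t v := by
    intro v v' y _ _ _ _ hy _ _ hm
    unfold height
    split_ifs <;> omega
  rcases mv with mv | mv
  · have sv := stay v y hv hvn hy hy1 hy2
    rcases mw with mw | mw
    · have sw := stay w z hw hwn hz hz1 hz2
      have := hcr mv mw
      subst mv mw
      omega
    · have sw := move w w' z hw hwn hw' hwn' hz hz1 hz2 mw
      subst mv
      omega
  · have sv := move v v' y hv hvn hv' hvn' hy hy1 hy2 mv
    rcases mw with mw | mw
    · have sw := stay w z hw hwn hz hz1 hz2
      subst mw
      omega
    · have sw := move w w' z hw hwn hw' hwn' hz hz1 hz2 mw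
      omega

/-- Two trajectories cross at the direction `s + 1`: each of them passes through it without
moving, and the two points are the ends of one chord in that direction. -/
def Cross (f g : ZMod n → ZMod n) (s : ZMod n) : Prop :=
  f (s + 1) = f s ∧ g (s + 1) = g s ∧ f s + g s = s + 1

lemma Cross.symm {f g : ZMod n → ZMod n} {s : ZMod n} (h : Cross f g s) : Cross g f s :=
  ⟨h.2.1, h.1, by rw [add_comm]; exact h.2.2⟩

/-- A half turn reverses the order of the heights, so two trajectories have to cross. -/
lemma IsTraj.exists_cross [NeZero n] {k : ℕ} {R : ZMod n → ZMod n → Prop} (hk : 0 < k)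
    {f g : ZMod n → ZMod n} (hf : IsTraj k R f) (hg : IsTraj k R g) (hfg : f ≠ g) :
    ∃ s, Cross f g s := by
  by_contra hno
  have hn : (0 : ℤ) < n := by have := NeZero.pos n; omega
  have main : ∀ f g : ZMod n → ZMod n, IsTraj k R f → IsTraj k R g → (∀ s, f s ≠ g s) →
      (¬ ∃ s, Cross f g s) → ¬ height n 0 (f 0).val < height n 0 (g 0).val := by
    intro f g hf hg hne hno hlt
    have key : ∀ t : ℕ, t ≤ n → height n t (f t).val < height n t (g t).val := by
      intro t
      induction t with
      | zero => intro _; simpa using hlt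
      | succ t ih =>
        intro htn
        have ih := ih (by omega)
        have act : ∀ f, IsTraj k R f →
            (((t : ZMod n) - 2 * f t).val : ℤ) = t - 2 * (f t).val ∨
            (((t : ZMod n) - 2 * f t).val : ℤ) = t - 2 * (f t).val + n ∨
            (((t : ZMod n) - 2 * f t).val : ℤ) = t - 2 * (f t).val - n ∨
            (((t : ZMod n) - 2 * f t).val : ℤ) = t - 2 * (f t).val + 2 * n := by
          intro f hf
          have := ZMod.val_lt (f t)
          exact val_cases _ _ (by simp) (by omega) (by omega)
        have mv : ∀ f, IsTraj k R f → ((f (t + 1)).val : ℤ) = (f t).val ∨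
            ((f (t + 1)).val : ℤ) = t + 1 - (f t).val ∨
            ((f (t + 1)).val : ℤ) = t + 1 - (f t).val + n := by
          intro f hf
          have h0 := ZMod.val_lt (f t)
          have h0' := ZMod.val_lt (f (t + 1))
          rcases hf.stay_or_move t with ⟨-, h⟩ | ⟨-, h⟩
          · have := val_cases (f (t + 1)) (t + 1 - (f t).val) (by rw [h]; simp) (by omega)
              (by omega)
            omega
          · left; rw [h]
        have a1 := (hf t).1
        have a2 := (hg t).1
        have b1 := ZMod.val_lt (f t)
        have b2 := ZMod.val_lt (g t)
        have b3 := ZMod.val_lt (f (t + 1))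
        have b4 := ZMod.val_lt (g (t + 1))
        rw [Act] at a1 a2
        have := height_step (k := k) (n := n) (t := t) hk (by omega) (by omega) (by omega)
          (by omega) (by omega) (by omega) (by omega) (by omega) (by omega) (by omega) (act f hf)
          (act g hg) (by omega) (by omega) (by omega) (by omega) (mv f hf) (mv g hg)
          (fun h => hne (t + 1) (ZMod.val_injective n (by omega))) ?_ ih
        · push_cast
          exact this
        · intro e1 e2
          have e1 : f (t + 1) = f t := ZMod.val_injective n (by omega)
          have e2 : g (t + 1) = g t := ZMod.val_injective n (by omega)
          by_contra hc
          refine hno ⟨t, e1, e2, ?_⟩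
          have hc : (((f t).val + (g t).val : ℤ) : ZMod n) = ((t + 1 : ℤ) : ZMod n) := by
            rcases not_and_or.1 hc with h | h
            · rw [not_not.1 h]
            · rw [not_not.1 h]; simp
          simpa using hc
    have h := key n le_rfl
    have b1 := ZMod.val_lt (f 0)
    have b2 := ZMod.val_lt (g 0)
    rw [ZMod.natCast_self, height_reverse (by omega) (by omega),
      height_reverse (by omega) (by omega)] at h
    omega
  have hne : ∀ s, f s ≠ g s := fun s h => hfg (hf.eq_of_eq hg h)
  have h1 := main f g hf hg hne hno
  have h2 := main g f hg hf (fun s => (hne s).symm) (fun ⟨s, hs⟩ => hno ⟨s, hs.symm⟩)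
  have b1 := ZMod.val_lt (f 0)
  have b2 := ZMod.val_lt (g 0)
  refine hne 0 (ZMod.val_injective n ?_)
  have := height_inj (n := n) (t := 0) (v := (f 0).val) (w := (g 0).val) (by omega)
    (by omega) (by omega) (by omega) (by omega) (by omega)
  omega

/-! ### Two trajectories that cross twice -/

/-- `R` with the chord `ab` added. -/
def addChord (R : ZMod n → ZMod n → Prop) (a b : ZMod n) (v w : ZMod n) : Prop :=
  R v w ∨ (v = a ∧ w = b) ∨ (v = b ∧ w = a)

lemma turn_addChord_of_ne {k : ℕ} {R : ZMod n → ZMod n → Prop} {a b s v : ZMod n}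
    (h : v = a ∨ v = b → s ≠ a + b) : turn k (addChord R a b) s v = turn k R s v := by
  have : Ed k (addChord R a b) v (s - v) ↔ Ed k R v (s - v) := by
    unfold Ed addChord
    constructor
    · rintro ((h' | ⟨h1, h2⟩ | ⟨h1, h2⟩) | h')
      · exact Or.inl h'
      · exact absurd (by rw [← h2, h1]; ring) (h (Or.inl h1))
      · exact absurd (by rw [← h2, h1]; ring) (h (Or.inr h1))
      · exact Or.inr h'
    · rintro (h' | h')
      · exact Or.inl (Or.inl h')
      · exact Or.inr h'
  unfold turn
  by_cases hE : Ed k R v (s - v)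
  · rw [if_pos hE, if_pos (this.2 hE)]
  · rw [if_neg hE, if_neg (fun h' => hE (this.1 h'))]

lemma turn_addChord_left {k : ℕ} {R : ZMod n → ZMod n → Prop} {a b : ZMod n} :
    turn k (addChord R a b) (a + b) a = b := by
  rw [turn, if_pos, add_sub_cancel_left]
  rw [add_sub_cancel_left]
  exact Or.inl (Or.inr (Or.inl ⟨rfl, rfl⟩))

lemma turn_addChord_right {k : ℕ} {R : ZMod n → ZMod n → Prop} {a b : ZMod n} :
    turn k (addChord R a b) (a + b) b = a := by
  rw [turn, if_pos, add_sub_cancel_right]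
  rw [add_sub_cancel_right]
  exact Or.inl (Or.inr (Or.inr ⟨rfl, rfl⟩))

lemma IsTraj.not_ed [NeZero n] {k : ℕ} {R : ZMod n → ZMod n → Prop} (hk : 0 < k)
    {f : ZMod n → ZMod n} (hf : IsTraj k R f) {s : ZMod n} (h : f (s + 1) = f s) :
    ¬ Ed k R (f s) (s + 1 - f s) := by
  rcases hf.stay_or_move s with ⟨-, h'⟩ | h'
  · exact absurd (h'.symm.trans h) (ne_of_act hk (hf s).1)
  · exact h'.1

/-- A chord at which two trajectories cross is a diagonal, and it is not yet in use. -/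
lemma Cross.chord [NeZero n] {k : ℕ} {R : ZMod n → ZMod n → Prop} (hk : 0 < k)
    {f g : ZMod n → ZMod n} (hf : IsTraj k R f) (hg : IsTraj k R g) {s : ZMod n}
    (h : Cross f g s) : k < (g s - f s).val ∧ (g s - f s).val + k < n ∧ k < (f s - g s).val ∧
      (f s - g s).val + k < n ∧ ¬ R (f s) (g s) := by
  obtain ⟨h1, h2, h3⟩ := h
  have e1 : s + 1 - f s = g s := by rw [← h3, add_sub_cancel_left]
  have e2 : s + 1 - g s = f s := by rw [← h3, add_sub_cancel_right]
  have a1 := val_succ_of_act hk (hf s).1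
  have a2 := val_succ_of_act hk (hg s).1
  have a3 := (hf s).1
  have a4 := (hg s).1
  have hne := ne_of_act hk (hf s).1
  have nf := hf.not_ed hk h1
  rw [e1] at a1 hne nf
  rw [e2] at a2
  have := val_neg_add_val hne
  unfold Act at a3 a4
  refine ⟨by omega, by omega, by omega, by omega, fun h => nf (Or.inl h)⟩

/-- After adding the two chords at which `f` and `g` cross, a trajectory can follow `f` outside the
interval between the two crossings and `g` inside. -/
lemma IsTraj.swap [NeZero n] {k : ℕ} {R : ZMod n → ZMod n → Prop}
    {f g : ZMod n → ZMod n} (hf : IsTraj k R f) (hg : IsTraj k R g) {s₁ s₂ : ZMod n}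
    (h₁ : Cross f g s₁) (h₂ : Cross f g s₂) (hs : s₁ ≠ s₂) :
    IsTraj k (addChord (addChord R (f s₁) (g s₁)) (f s₂) (g s₂))
      (fun s => if (s - (s₁ + 1)).val < (s₂ - s₁).val then g s else f s) := by
  -- Away from the crossings, a step does not enter or leave the interval.
  have key : ∀ s : ZMod n, s ≠ s₁ → s ≠ s₂ →
      ((s + 1 - (s₁ + 1)).val < (s₂ - s₁).val ↔ (s - (s₁ + 1)).val < (s₂ - s₁).val) := by
    intro s h1 h2
    have p1 := (val_pos_iff (s - s₁)).2 (sub_ne_zero.2 h1)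
    have p2 := ZMod.val_lt (s - s₁)
    have p3 : (s - s₁).val ≠ (s₂ - s₁).val := fun h =>
      h2 (sub_left_injective (ZMod.val_injective n h))
    have p4 := val_cases (s - (s₁ + 1)) ((s - s₁).val - 1 : ℤ)
      (by push_cast; rw [ZMod.natCast_zmod_val]; ring) (by omega) (by omega)
    have p5 := ZMod.val_lt (s - (s₁ + 1))
    rw [show s + 1 - (s₁ + 1) = s - s₁ by ring]
    omega
  have q1 := (val_pos_iff (s₂ - s₁)).2 (sub_ne_zero.2 hs.symm)
  have q2 := ZMod.val_lt (s₂ - s₁)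
  have hdis : ∀ s, s ≠ s₁ → s ≠ s₂ → ∀ v,
      turn k (addChord (addChord R (f s₁) (g s₁)) (f s₂) (g s₂)) (s + 1) v =
        turn k R (s + 1) v := by
    intro s h1 h2 v
    rw [turn_addChord_of_ne, turn_addChord_of_ne]
    · rw [h₁.2.2]
      exact fun _ h => h1 (add_left_injective 1 h)
    · rw [h₂.2.2]
      exact fun _ h => h2 (add_left_injective 1 h)
  intro s
  constructor
  · dsimp only
    split_ifs
    · exact (hg s).1
    · exact (hf s).1
  · by_cases e1 : s = s₁
    · subst e1
      have c1 : ¬ (s - (s + 1)).val < (s₂ - s).val := by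
        have p4 := val_cases (s - (s + 1)) (-1 : ℤ) (by push_cast; ring) (by omega) (by omega)
        omega
      have c2 : (s + 1 - (s + 1)).val < (s₂ - s).val := by simpa using q1
      dsimp only
      rw [if_neg c1, if_pos c2, turn_addChord_of_ne, ← h₁.2.2, turn_addChord_left, h₁.2.2,
        h₁.2.1]
      rw [h₂.2.2]
      exact fun _ h => hs (add_left_injective 1 h)
    · by_cases e2 : s = s₂
      · subst e2
        have c1 : (s - (s₁ + 1)).val < (s - s₁).val := by
          have p4 := val_cases (s - (s₁ + 1)) ((s - s₁).val - 1 : ℤ)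
            (by push_cast; rw [ZMod.natCast_zmod_val]; ring) (by omega) (by omega)
          have p5 := ZMod.val_lt (s - (s₁ + 1))
          omega
        have c2 : ¬ (s + 1 - (s₁ + 1)).val < (s - s₁).val := by
          rw [show s + 1 - (s₁ + 1) = s - s₁ by ring]
          omega
        dsimp only
        rw [if_pos c1, if_neg c2, ← h₂.2.2, turn_addChord_right, h₂.2.2, h₂.1]
      · have c := key s e1 e2
        dsimp only
        rw [hdis s e1 e2]
        by_cases h : (s - (s₁ + 1)).val < (s₂ - s₁).val
        · rw [if_pos h, if_pos (c.2 h)]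
          exact (hg s).2
        · rw [if_neg h, if_neg (fun h' => h (c.1 h'))]
          exact (hf s).2

/-- Adding the chords at two crossings of the same pair of trajectories leaves every position on a
closed trajectory. -/
lemma Covered.addChord₂ [NeZero n] {k : ℕ} {R : ZMod n → ZMod n → Prop} (hc : Covered k R)
    {f g : ZMod n → ZMod n} (hf : IsTraj k R f) (hg : IsTraj k R g) (hfg : f ≠ g)
    {s₁ s₂ : ZMod n} (h₁ : Cross f g s₁) (h₂ : Cross f g s₂) (hs : s₁ ≠ s₂) :
    Covered k (addChord (addChord R (f s₁) (g s₁)) (f s₂) (g s₂)) := by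
  have hsymm : addChord (addChord R (f s₁) (g s₁)) (f s₂) (g s₂) =
      addChord (addChord R (g s₁) (f s₁)) (g s₂) (f s₂) := by
    funext v w
    unfold addChord
    rw [eq_iff_iff]
    tauto
  have t1 := hf.swap hg h₁ h₂ hs
  have t2 := hg.swap hf h₁.symm h₂.symm hs
  rw [← hsymm] at t2
  intro s v hv
  obtain ⟨h, hh, rfl⟩ := hc s v hv
  by_cases ef : h = f
  · subst ef
    by_cases c : (s - (s₁ + 1)).val < (s₂ - s₁).val
    · exact ⟨_, t2, if_pos c⟩
    · exact ⟨_, t1, if_neg c⟩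
  by_cases eg : h = g
  · subst eg
    by_cases c : (s - (s₁ + 1)).val < (s₂ - s₁).val
    · exact ⟨_, t1, if_pos c⟩
    · exact ⟨_, t2, if_neg c⟩
  refine ⟨h, fun t => ⟨(hh t).1, ?_⟩, rfl⟩
  have nf : ∀ t, h t ≠ f t := fun t e => ef (hh.eq_of_eq hf e)
  have ng : ∀ t, h t ≠ g t := fun t e => eg (hh.eq_of_eq hg e)
  have nn : ∀ s', Cross f g s' → h t = f s' ∨ h t = g s' → t + 1 ≠ f s' + g s' := by
    intro s' hs' h' e
    rw [hs'.2.2] at e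
    have e : t = s' := add_left_injective 1 e
    subst e
    exact h'.elim (nf t) (ng t)
  rw [turn_addChord_of_ne (nn s₂ h₂), turn_addChord_of_ne (nn s₁ h₁)]
  exact (hh t).2

/-- If every position lies on a closed trajectory and no two trajectories cross twice, then each
trajectory crosses every other one exactly once, so that it stays in place `n - 2k - 1` times. -/
lemma IsTraj.card_move [NeZero n] {k : ℕ} {R : ZMod n → ZMod n → Prop} (hk : 0 < k)
    (hn : 2 * k + 1 ≤ n) (hR : IsDiagRel k R) (hc : Covered k R)
    (hone : ∀ f g s₁ s₂, IsTraj k R f → IsTraj k R g → f ≠ g → Cross f g s₁ → Cross f g s₂ →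
      s₁ = s₂) {f : ZMod n → ZMod n} (hf : IsTraj k R f) :
    (Finset.univ.filter (fun s => f (s + 1) ≠ f s)).card = 2 * k + 1 := by
  classical
  -- A stay at direction `s + 1` is sent to the trajectory through the other end of the chord, and
  -- a trajectory is identified by its position in direction `-1`.
  have hstay : (Finset.univ.filter (fun s => f (s + 1) = f s)).card =
      ((Finset.univ.filter (Act (n := n) k (-1))).erase (f (-1))).card := by
    have hact : ∀ s, f (s + 1) = f s → Act k s (s + 1 - f s) := by
      intro s hs
      have h1 := hf.not_ed hk hs
      have h2 := (hf (s + 1)).1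
      have h3 := val_succ_of_act hk (hf s).1
      have h4 := val_neg_add_val (ne_of_act hk (hf s).1)
      rw [Act, hs, show s + 1 - 2 * f s = s + 1 - f s - f s by ring] at h2
      have h5 : (s + 1 - f s - f s).val ≠ k := fun h =>
        h1 (Or.inr (Or.inl ((natCast_val_eq (by omega)).1 h)))
      have h6 := val_cases (s - 2 * (s + 1 - f s)) ((f s - (s + 1 - f s)).val - 1 : ℤ)
        (by push_cast; rw [ZMod.natCast_zmod_val]; ring) (by omega) (by omega)
      have h7 := ZMod.val_lt (s - 2 * (s + 1 - f s))
      rw [Act]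
      omega
    choose T hT hTv using hc
    have hcross : ∀ s (hs : f (s + 1) = f s),
        Cross f (T s _ (hact s hs)) s ∧ f ≠ T s _ (hact s hs) := by
      intro s hs
      have h1 := hTv s _ (hact s hs)
      set g := T s _ (hact s hs) with hg
      refine ⟨⟨hs, ?_, by rw [h1]; ring⟩, ?_⟩
      · rcases (hT s _ (hact s hs)).stay_or_move s with h | h
        · have := h.1
          rw [← hg, h1, sub_sub_cancel] at this
          exact absurd (this.symm hR) (hf.not_ed hk hs)
        · exact h.2
      · intro h
        rw [← h] at h1
        exact ne_of_act hk (hf s).1 h1.symm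
    refine Finset.card_bij (fun s hs => T s _ (hact s (Finset.mem_filter.1 hs).2) (-1)) ?_ ?_ ?_
    · intro s hs
      refine Finset.mem_erase.2 ⟨?_, Finset.mem_filter.2 ⟨Finset.mem_univ _, (hT s _ _ _).1⟩⟩
      intro h
      exact (hcross s (Finset.mem_filter.1 hs).2).2 (hf.eq_of_eq (hT s _ _) h.symm)
    · intro s hs s' hs' h
      have e := (hT s _ (hact s (Finset.mem_filter.1 hs).2)).eq_of_eq (hT s' _ _) h
      obtain ⟨c1, c2⟩ := hcross s (Finset.mem_filter.1 hs).2
      obtain ⟨c3, c4⟩ := hcross s' (Finset.mem_filter.1 hs').2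
      rw [← e] at c3
      exact hone _ _ _ _ hf (hT s _ _) c2 c1 c3
    · intro v hv
      rw [Finset.mem_erase, Finset.mem_filter] at hv
      have g1 := hTv (-1) v hv.2.2
      have g2 := hT (-1) v hv.2.2
      set g := T (-1) v hv.2.2 with hg
      obtain ⟨s, hs⟩ := hf.exists_cross hk g2 (fun h => hv.1 (by rw [h, g1]))
      refine ⟨s, Finset.mem_filter.2 ⟨Finset.mem_univ _, hs.1⟩, ?_⟩
      rw [← g1]
      refine congrFun ((hT s _ _).eq_of_eq g2 (s := s) ?_) _
      rw [hTv, ← hs.2.2, add_sub_cancel_left]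
  have h1 := Finset.card_filter_add_card_filter_not (s := (Finset.univ : Finset (ZMod n)))
    (fun s => f (s + 1) = f s)
  rw [Finset.card_univ, ZMod.card, hstay, Finset.card_erase_of_mem, card_act hk hn] at h1
  · simp only [ne_eq]
    omega
  · exact Finset.mem_filter.2 ⟨Finset.mem_univ _, (hf _).1⟩

/-! ### Cycles as sequences of labels -/

/-- `vw` is a directed edge of the subdivided polygon. -/
def Out (k : ℕ) (R : ZMod n → ZMod n → Prop) (v w : ZMod n) : Prop := R v w ∨ v = w + k

/-- The edge `vw` follows the edge `uv` in the cycle decomposition. -/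
structure Next (k : ℕ) (R : ZMod n → ZMod n → Prop) (u v w : ZMod n) : Prop where
  out₁ : Out k R u v
  out₂ : Out k R v w
  lt : (u - v).val < (w - v).val
  not_split : ∀ x, R v x → ¬ ((u - v).val < (x - v).val ∧ (x - v).val < (w - v).val)

lemma Ed.of_out {k : ℕ} {R : ZMod n → ZMod n → Prop} {v w : ZMod n} (h : Out k R v w) : Ed k R v w := by
  rcases h with h | h
  · exact Or.inl h
  · exact Or.inr (Or.inr h)

/-- The time at which the `j`-th edge of the closed walk `a` is traversed, counted from the edge
`a 0`, `a 1`. -/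
def time (a : ℕ → ZMod n) (j : ℕ) : ℕ := ∑ i ∈ Finset.range j, (a (i + 2) - a i).val

lemma time_succ (a : ℕ → ZMod n) (j : ℕ) : time a (j + 1) = time a j + (a (j + 2) - a j).val :=
  Finset.sum_range_succ _ _

section
variable [NeZero n] {k : ℕ} {R : ZMod n → ZMod n → Prop}

lemma Out.val_in (hn : 2 * k + 1 ≤ n) (hR : IsDiagRel k R) {u v : ZMod n} (h : Out k R u v) :
    k ≤ (u - v).val ∧ (u - v).val + k < n := by
  rcases h with h | h
  · have h1 := hR.lo _ _ (hR.symm _ _ h)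
    have h2 := hR.hi _ _ (hR.symm _ _ h)
    omega
  · have := (natCast_val_eq (by omega)).2 h
    omega

lemma val_sub_of_eq_add (hk : 0 < k) (hn : 2 * k + 1 ≤ n) {v w : ZMod n} (h : v = w + k) :
    (w - v).val + k = n := by
  have h1 := (natCast_val_eq (k := k) (by omega)).2 h
  have h2 := val_neg_add_val (a := v) (b := w) (fun e => by
    rw [e, sub_self, ZMod.val_zero] at h1; omega)
  omega

lemma Out.val_out (hk : 0 < k) (hn : 2 * k + 1 ≤ n) (hR : IsDiagRel k R) {v w : ZMod n}
    (h : Out k R v w) : k < (w - v).val ∧ (w - v).val + k ≤ n := by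
  rcases h with h | h
  · have h1 := hR.lo _ _ h
    have h2 := hR.hi _ _ h
    omega
  · have := val_sub_of_eq_add hk hn h
    omega

lemma Out.ne (hk : 0 < k) (hn : 2 * k + 1 ≤ n) (hR : IsDiagRel k R) {v w : ZMod n}
    (h : Out k R v w) : w ≠ v := by
  rintro rfl
  have := (h.val_out hk hn hR).1
  rw [sub_self, ZMod.val_zero] at this
  omega

lemma Next.unique (hk : 0 < k) (hn : 2 * k + 1 ≤ n) (hR : IsDiagRel k R) {u v w w' : ZMod n}
    (h : Next k R u v w) (h' : Next k R u v w') : w = w' := by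
  have main : ∀ w w', Next k R u v w → Next k R u v w' → ¬ (w - v).val < (w' - v).val := by
    intro w w' h h' hlt
    rcases h.out₂ with h1 | h1
    · exact h'.not_split w h1 ⟨h.lt, hlt⟩
    · have h2 := val_sub_of_eq_add hk hn h1
      have h3 := h'.out₂.val_out hk hn hR
      omega
  have h1 := main w w' h h'
  have h2 := main w' w h' h
  exact sub_left_injective (ZMod.val_injective n (by omega : (w - v).val = (w' - v).val))

lemma Out.exists_next (hk : 0 < k) (hn : 2 * k + 1 ≤ n) (hR : IsDiagRel k R) {u v : ZMod n}
    (h : Out k R u v) : ∃ w, Next k R u v w := by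
  classical
  have hval : ∀ i, i < n → ((v + (i : ℕ)) - v).val = i := fun i hi => by
    rw [add_sub_cancel_left, ZMod.val_natCast_of_lt hi]
  have hin := h.val_in hn hR
  have hex : ∃ i, (u - v).val < i ∧ i + k ≤ n ∧ Out k R v (v + (i : ℕ)) :=
    ⟨n - k, by omega, by omega, Or.inr (by rw [Nat.cast_sub (by omega)]; simp)⟩
  obtain ⟨h1, h2, h3⟩ := Nat.find_spec hex
  refine ⟨_, h, h3, by rw [hval _ (by omega)]; exact h1, ?_⟩
  rintro x hx ⟨h4, h5⟩
  rw [hval _ (by omega)] at h5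
  refine Nat.find_min hex h5 ⟨h4, by omega, Or.inl ?_⟩
  simpa using hx

/-- The time between the arrival at `v` from `u` and the departure from `v` to `w`. -/
lemma Next.val_sub (hk : 0 < k) (hn : 2 * k + 1 ≤ n) (hR : IsDiagRel k R) {u v w : ZMod n}
    (h : Next k R u v w) : 0 < (w - u).val ∧ (w - u).val + (u - v).val = (w - v).val := by
  have h1 := h.out₁.val_in hn hR
  have h2 := h.lt
  have h3 := ZMod.val_lt (w - v)
  have h4 := ZMod.val_lt (w - u)
  have h5 := val_sub_cases (w - v) (u - v)
  rw [sub_sub_sub_cancel_right] at h5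
  omega

/-- A point that arrives at `v` along `uv` stays there until the chord reaches `w`, and then it
leaves along `vw`. -/
lemma Next.run (hk : 0 < k) (hn : 2 * k + 1 ≤ n) (hR : IsDiagRel k R) {u v w s : ZMod n}
    (h : Next k R u v w) {g : ℕ → ZMod n}
    (hg : ∀ i, g (i + 1) = turn k R (s + (i + 1 : ℕ)) (g i)) {t : ℕ} (ht : g t = v)
    (hs : s + t = u + v) :
    (∀ i < (w - u).val, g (t + i) = v) ∧ g (t + (w - u).val) = w ∧
      s + (t + (w - u).val : ℕ) = v + w := by
  obtain ⟨h1, h2⟩ := h.val_sub hk hn hR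
  have h3 := h.out₁.val_in hn hR
  have h4 := h.out₂.val_out hk hn hR
  have chord : ∀ i : ℕ, s + ((t + i : ℕ) : ZMod n) - v = u + i := by
    intro i
    push_cast
    rw [← add_assoc, hs]
    ring
  have hstay : ∀ i < (w - u).val, g (t + i) = v := by
    intro i
    induction i with
    | zero => intro _; exact ht
    | succ i ih =>
      intro hi
      have := hg (t + i)
      rw [ih (by omega)] at this
      rw [← add_assoc, this, turn, if_neg]
      rw [add_assoc t i 1, chord]
      have hv := val_cases (u + ((i + 1 : ℕ) : ZMod n) - v) ((u - v).val + (i + 1 : ℕ) : ℤ)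
        (by push_cast; rw [ZMod.natCast_zmod_val]; ring) (by omega) (by omega)
      have hv' := ZMod.val_lt (u + ((i + 1 : ℕ) : ZMod n) - v)
      rintro (hr | hr | hr)
      · refine h.not_split _ hr ?_
        omega
      · have := (natCast_val_eq (k := k) (by omega)).2 hr
        omega
      · have := val_sub_of_eq_add hk hn hr
        omega
  refine ⟨hstay, ?_, ?_⟩
  · obtain ⟨d, hd⟩ : ∃ d, (w - u).val = d + 1 := ⟨(w - u).val - 1, by omega⟩
    have := hg (t + d)
    rw [hstay d (by omega), add_assoc t d 1, ← hd] at this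
    rw [this, turn, chord, ZMod.natCast_zmod_val, add_sub_cancel, if_pos (Ed.of_out h.out₂)]
  · have := chord (w - u).val
    rw [ZMod.natCast_zmod_val, add_sub_cancel, sub_eq_iff_eq_add] at this
    rw [this, add_comm]

/-- Consecutive edges of the sequence follow each other in the cycle decomposition. -/
def IsNextSeq (k : ℕ) (R : ZMod n → ZMod n → Prop) (a : ℕ → ZMod n) : Prop :=
  ∀ j, Next k R (a j) (a (j + 1)) (a (j + 2))

lemma Out.exists_seq (hk : 0 < k) (hn : 2 * k + 1 ≤ n) (hR : IsDiagRel k R) {u v : ZMod n}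
    (h : Out k R u v) : ∃ a, IsNextSeq k R a ∧ a 0 = u ∧ a 1 = v := by
  choose! F hF using fun (e : ZMod n × ZMod n) (h : Out k R e.1 e.2) => h.exists_next hk hn hR
  let E : ℕ → ZMod n × ZMod n := fun j => Nat.rec (u, v) (fun _ e => (e.2, F e)) j
  have hE : ∀ j, Out k R (E j).1 (E j).2 := by
    intro j
    induction j with
    | zero => exact h
    | succ j ih => exact (hF _ ih).out₂
  exact ⟨fun j => (E j).1, fun j => hF (E j) (hE j), rfl, rfl⟩

lemma IsNextSeq.run (hk : 0 < k) (hn : 2 * k + 1 ≤ n) (hR : IsDiagRel k R) {a : ℕ → ZMod n}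
    (ha : IsNextSeq k R a) {g : ℕ → ZMod n} {s : ZMod n}
    (hg : ∀ i, g (i + 1) = turn k R (s + (i + 1 : ℕ)) (g i)) (hs : s = a 0 + a 1)
    (h0 : g 0 = a 1) (j : ℕ) :
    g (time a j) = a (j + 1) ∧ s + (time a j : ZMod n) = a j + a (j + 1) := by
  induction j with
  | zero => simp [time, h0, hs]
  | succ j ih =>
    have := (ha j).run hk hn hR hg ih.1 ih.2
    rw [time_succ]
    exact this.2

lemma IsNextSeq.stay (hk : 0 < k) (hn : 2 * k + 1 ≤ n) (hR : IsDiagRel k R) {a : ℕ → ZMod n}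
    (ha : IsNextSeq k R a) {g : ℕ → ZMod n} {s : ZMod n}
    (hg : ∀ i, g (i + 1) = turn k R (s + (i + 1 : ℕ)) (g i)) (hs : s = a 0 + a 1)
    (h0 : g 0 = a 1) {j i : ℕ} (h1 : time a j ≤ i) (h2 : i < time a (j + 1)) :
    g i = a (j + 1) := by
  obtain ⟨e1, e2⟩ := ha.run hk hn hR hg hs h0 j
  obtain ⟨d, rfl⟩ := Nat.exists_eq_add_of_le h1
  rw [time_succ] at h2
  exact ((ha j).run hk hn hR hg e1 e2).1 d (by omega)

lemma IsNextSeq.time_lt (hk : 0 < k) (hn : 2 * k + 1 ≤ n) (hR : IsDiagRel k R) {a : ℕ → ZMod n}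
    (ha : IsNextSeq k R a) (j : ℕ) : time a j < time a (j + 1) := by
  rw [time_succ]
  have := ((ha j).val_sub hk hn hR).1
  omega

/-- The point moves exactly once for each edge of the walk. -/
lemma IsNextSeq.count_move (hk : 0 < k) (hn : 2 * k + 1 ≤ n) (hR : IsDiagRel k R)
    {a : ℕ → ZMod n} (ha : IsNextSeq k R a) {g : ℕ → ZMod n} {s : ZMod n}
    (hg : ∀ i, g (i + 1) = turn k R (s + (i + 1 : ℕ)) (g i)) (hs : s = a 0 + a 1)
    (h0 : g 0 = a 1) (j : ℕ) :
    (∑ i ∈ Finset.range (time a j), if g (i + 1) ≠ g i then 1 else 0) = j := by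
  induction j with
  | zero => simp [time]
  | succ j ih =>
    have hlt := ha.time_lt hk hn hR j
    have hr := ha.run hk hn hR hg hs h0 (j + 1)
    obtain ⟨d, hd⟩ : ∃ d, time a (j + 1) = time a j + d + 1 :=
      ⟨time a (j + 1) - time a j - 1, by omega⟩
    have hst : ∀ i, i < d + 1 → g (time a j + i) = a (j + 1) := fun i hi =>
      ha.stay hk hn hR hg hs h0 (j := j) (by omega) (by omega)
    rw [hd] at hr
    rw [hd, Finset.sum_range_succ, Finset.sum_range_add, ih, Finset.sum_eq_zero, add_zero,
      if_pos]
    · rw [hr.1, hst d (by omega)]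
      exact (ha (j + 1)).out₁.ne hk hn hR
    · intro i hi
      rw [Finset.mem_range] at hi
      rw [if_neg]
      rw [not_not, add_assoc, hst (i + 1) (by omega), hst i (by omega)]

/-! ### Walks that close up after a half turn -/

lemma Out.act (hn : 2 * k + 1 ≤ n) (hR : IsDiagRel k R) {u v : ZMod n} (h : Out k R u v) :
    Act k (u + v) v := by
  rw [Act, show u + v - 2 * v = u - v by ring]
  exact h.val_in hn hR

/-- A closed walk along the cycle decomposition that takes exactly a half turn gives a closed
trajectory. -/
lemma IsNextSeq.exists_traj (hk : 0 < k) (hn : 2 * k + 1 ≤ n) (hR : IsDiagRel k R)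
    {a : ℕ → ZMod n} (ha : IsNextSeq k R a) {M : ℕ} (hM : a (M + 1) = a 1) (ht : time a M = n) :
    ∃ f, IsTraj k R f ∧ (∀ j i, time a j ≤ i → i < time a (j + 1) → i < n →
      f (a 0 + a 1 + i) = a (j + 1)) ∧
      (Finset.univ.filter (fun s => f (s + 1) ≠ f s)).card = M := by
  set s := a 0 + a 1 with hs
  obtain ⟨g, h0, hg⟩ : ∃ g : ℕ → ZMod n, g 0 = a 1 ∧
      ∀ i, g (i + 1) = turn k R (s + (i + 1 : ℕ)) (g i) :=
    ⟨fun i => Nat.rec (a 1) (fun i v => turn k R (s + (i + 1 : ℕ)) v) i, rfl, fun _ => rfl⟩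
  have hact : ∀ i : ℕ, Act k (s + (i : ZMod n)) (g i) := by
    intro i
    induction i with
    | zero =>
      rw [Nat.cast_zero, add_zero, h0]
      exact (ha 0).out₁.act hn hR
    | succ i ih =>
      rw [hg]
      push_cast
      rw [← add_assoc]
      exact ih.turn hk hn
  have hgn : g n = g 0 := by
    have := (ha.run hk hn hR hg hs h0 M).1
    rw [ht] at this
    rw [this, hM, h0]
  have hv : ∀ i : ℕ, i < n → (s + i - s).val = i := fun i hi => by
    rw [add_sub_cancel_left, ZMod.val_natCast_of_lt hi]
  have hf1 : ∀ i : ℕ, i < n → g ((s + i + 1 - s).val) = g (i + 1) := by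
    intro i hi
    by_cases h : i + 1 < n
    · have := hv (i + 1) h
      push_cast at this
      rw [add_assoc, this]
    · have h : i + 1 = n := by omega
      have : s + i + 1 - s = 0 := by
        have : ((i + 1 : ℕ) : ZMod n) = 0 := by rw [h]; simp
        push_cast at this
        rw [add_assoc, this]
        simp
      rw [this, ZMod.val_zero, h, hgn]
  have hcast : ∀ t : ZMod n, s + ((t - s).val : ℕ) = t := fun t => by simp
  obtain ⟨f, hf⟩ : ∃ f : ZMod n → ZMod n, ∀ t, f t = g (t - s).val := ⟨_, fun _ => rfl⟩
  have hfs : ∀ t, f (t + 1) = g ((t - s).val + 1) := by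
    intro t
    have := hf1 (t - s).val (ZMod.val_lt _)
    rwa [hcast, ← hf] at this
  refine ⟨f, fun t => ⟨?_, ?_⟩, ?_, ?_⟩
  · have := hact (t - s).val
    rwa [hcast, ← hf] at this
  · rw [hfs, hf, hg]
    push_cast
    rw [← add_assoc, hcast]
  · intro j i h1 h2 h3
    rw [hf, hv i h3]
    exact ha.stay hk hn hR hg hs h0 h1 h2
  · have hc := ha.count_move hk hn hR hg hs h0 M
    rw [ht] at hc
    have hc : ((Finset.range n).filter (fun i => g (i + 1) ≠ g i)).card = M := by
      rw [Finset.card_filter]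
      exact hc
    rw [← hc]
    refine Finset.card_bij (fun t _ => (t - s).val) ?_ ?_ ?_
    · intro t h
      rw [Finset.mem_filter] at h ⊢
      rw [← hfs, ← hf]
      exact ⟨Finset.mem_range.2 (ZMod.val_lt _), h.2⟩
    · intro t _ t' _ h
      exact sub_left_injective (ZMod.val_injective n h)
    · intro i hi
      rw [Finset.mem_filter, Finset.mem_range] at hi
      refine ⟨s + i, ?_, hv i hi.1⟩
      rw [Finset.mem_filter, hfs, hf, hv i hi.1]
      exact ⟨Finset.mem_univ _, hi.2⟩

/-- Conversely, the walk along a closed trajectory closes up after exactly a half turn. -/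
lemma IsTraj.exists_period (hk : 0 < k) (hn : 2 * k + 1 ≤ n) (hR : IsDiagRel k R)
    {a : ℕ → ZMod n} (ha : IsNextSeq k R a) {f : ZMod n → ZMod n} (hf : IsTraj k R f)
    (h : f (a 0 + a 1) = a 1) : ∃ M, 0 < M ∧ time a M = n ∧ a M = a 0 ∧ a (M + 1) = a 1 := by
  set s := a 0 + a 1 with hs
  let g : ℕ → ZMod n := fun i => f (s + i)
  have h0 : g 0 = a 1 := by simpa [g] using h
  have hg : ∀ i, g (i + 1) = turn k R (s + (i + 1 : ℕ)) (g i) := fun i => by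
    simp only [g]
    push_cast
    rw [← add_assoc]
    exact (hf _).2
  have hge : ∀ j, j ≤ time a j := by
    intro j
    induction j with
    | zero => omega
    | succ j ih =>
      have := ha.time_lt hk hn hR j
      omega
  have hex : ∃ j, n < time a (j + 1) := ⟨n, hge (n + 1)⟩
  classical
  obtain ⟨j, h1, h2⟩ : ∃ j, time a j ≤ n ∧ n < time a (j + 1) := by
    refine ⟨Nat.find hex, ?_, Nat.find_spec hex⟩
    cases hj : Nat.find hex with
    | zero => simp [time]
    | succ j =>
      have := Nat.find_min hex (m := j) (by omega)
      omega
  have hn0 := NeZero.pos n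
  have hgn : g n = a 1 := by simpa [g] using h
  -- The point arrives at `a 1` from `a 0` at time `0`, hence it also moves at time `n`, and moves
  -- happen only at the times `time a j`.
  have heq : time a j = n := by
    by_contra hne
    have e1 := ha.stay hk hn hR hg hs h0 (j := j) (i := n - 1) (by omega) (by omega)
    have e2 := ha.stay hk hn hR hg hs h0 (j := j) (i := n) (by omega) (by omega)
    have e3 := hg (n - 1)
    rw [Nat.sub_add_cancel hn0, ZMod.natCast_self, add_zero] at e3
    have e4 := turn_turn hR s (g (n - 1))
    rw [← e3, hgn, turn, hs, add_sub_cancel_right, if_pos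
      ((Ed.of_out (ha 0).out₁).symm hR), e1, ← e2, hgn] at e4
    exact (ha 0).out₁.ne hk hn hR e4.symm
  obtain ⟨e1, e2⟩ := ha.run hk hn hR hg hs h0 j
  rw [heq] at e1 e2
  rw [hgn] at e1
  rw [ZMod.natCast_self, add_zero, ← e1, hs] at e2
  refine ⟨j, ?_, heq, (add_right_cancel e2).symm, e1.symm⟩
  by_contra hj
  have : j = 0 := by omega
  subst this
  simp only [time, Finset.range_zero, Finset.sum_empty] at heq
  omega

lemma IsNextSeq.periodic (hk : 0 < k) (hn : 2 * k + 1 ≤ n) (hR : IsDiagRel k R)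
    {a : ℕ → ZMod n} (ha : IsNextSeq k R a) {M : ℕ} (h0 : a M = a 0) (h1 : a (M + 1) = a 1)
    (j : ℕ) : a (j + M) = a j := by
  have : a (j + M) = a j ∧ a (j + 1 + M) = a (j + 1) := by
    induction j with
    | zero => exact ⟨by rw [zero_add, h0], by rw [zero_add, add_comm, h1]⟩
    | succ j ih =>
      refine ⟨ih.2, ?_⟩
      have e1 := ha (j + M)
      rw [show j + M + 1 = j + 1 + M by ring, show j + M + 2 = j + 1 + 1 + M by ring, ih.1,
        ih.2] at e1
      exact e1.unique hk hn hR (ha j)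
  exact this.1

/-- Every admissible position is passed by the walk along some edge. -/
lemma Act.exists_next (hk : 0 < k) (hn : 2 * k + 1 ≤ n) (hR : IsDiagRel k R) {s v : ZMod n}
    (h : Act k s v) : ∃ u w : ZMod n, ∃ i, Next k R u v w ∧ i < (w - u).val ∧ i < n ∧
      u + v + (i : ℕ) = s := by
  classical
  obtain ⟨h1, h2⟩ := h
  let P : ℕ → Prop := fun j => k ≤ (s - 2 * v).val - j ∧
    Out k R (v + ((s - 2 * v).val - j : ℕ)) v
  have hex : ∃ j, P j := by
    refine ⟨(s - 2 * v).val - k, by omega, Or.inr ?_⟩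
    rw [Nat.sub_sub_self h1]
  obtain ⟨h3, h4⟩ := Nat.find_spec hex
  set j := Nat.find hex with hj
  have hval : ∀ i, i < n → ((v + (i : ℕ)) - v).val = i := fun i hi => by
    rw [add_sub_cancel_left, ZMod.val_natCast_of_lt hi]
  obtain ⟨w, hw⟩ := h4.exists_next hk hn hR
  have hu := hval ((s - 2 * v).val - j) (by omega)
  obtain ⟨e1, e2⟩ := hw.val_sub hk hn hR
  refine ⟨_, w, j, hw, ?_, by omega, ?_⟩
  · by_contra hc
    have hwv := hw.out₂.val_out hk hn hR
    rcases hw.out₂ with hr | hr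
    · refine Nat.find_min hex (m := (s - 2 * v).val - (w - v).val) (by omega) ⟨by omega, Or.inl ?_⟩
      rw [Nat.sub_sub_self (by omega), ZMod.natCast_zmod_val, add_sub_cancel]
      exact hR.symm _ _ hr
    · have := val_sub_of_eq_add hk hn hr
      omega
  · rw [Nat.cast_sub (by omega), ZMod.natCast_zmod_val]
    ring

end

/-! ### Closed walks and stars -/

/-- A sequence in which each term determines both its neighbours returns to its start after as many
steps as it has different terms. -/
lemma eq_zero_of_card_range {α : Type*} {a : ℕ → α} {Q : Finset α}
    (hQ : (Q : Set α) = Set.range a) (hfwd : ∀ i j, a i = a j → a (i + 1) = a (j + 1))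
    (hbwd : ∀ i j, a (i + 1) = a (j + 1) → a i = a j) : a Q.card = a 0 := by
  classical
  have hmQ : ∀ j, a j ∈ Q := fun j => by
    rw [← Finset.mem_coe, hQ]
    exact ⟨j, rfl⟩
  have key : ∀ i d, a (d + i) = a i → a d = a 0 := by
    intro i
    induction i with
    | zero => intro d h; exact h
    | succ i ih => intro d h; exact ih d (hbwd _ _ h)
  obtain ⟨P, hP0, hPM, hPa⟩ : ∃ P, 0 < P ∧ P ≤ Q.card ∧ a P = a 0 := by
    obtain ⟨i, hi, j, hj, hij, h⟩ := Finset.exists_ne_map_eq_of_card_lt_of_maps_to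
      (s := Finset.range (Q.card + 1)) (t := Q) (f := a)
      (by rw [Finset.card_range]; omega) (fun j _ => hmQ j)
    rw [Finset.mem_range] at hi hj
    rcases Nat.lt_or_gt_of_ne hij with hl | hl
    · refine ⟨j - i, by omega, by omega, key i _ ?_⟩
      rw [Nat.sub_add_cancel hl.le, h]
    · refine ⟨i - j, by omega, by omega, key j _ ?_⟩
      rw [Nat.sub_add_cancel hl.le, h]
  have hper : Function.Periodic a P := by
    intro j
    induction j with
    | zero => rw [zero_add, hPa]
    | succ j ih =>
      rw [add_right_comm]
      exact hfwd _ _ ih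
  -- All terms occur among the first `P` ones, so that `P` is the number of different terms.
  have hle : Q.card ≤ P := by
    rw [← Finset.card_range P]
    refine (Finset.card_le_card (t := (Finset.range P).image a) ?_).trans Finset.card_image_le
    intro x hx
    rw [← Finset.mem_coe, hQ] at hx
    obtain ⟨j, rfl⟩ := hx
    rw [← hper.map_mod_nat]
    exact Finset.mem_image_of_mem _ (Finset.mem_range.2 (Nat.mod_lt _ hP0))
  rw [← hPa, le_antisymm hPM hle]

lemma time_shift {a : ℕ → ZMod n} {M : ℕ} (hper : Function.Periodic a M) (j : ℕ) :
    time (fun i => a (i + j)) M = time a M := by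
  induction j with
  | zero => rfl
  | succ j ih =>
    rw [← ih]
    have e1 := Finset.sum_range_succ' (fun i => (a (i + 2 + j) - a (i + j)).val) M
    rw [Finset.sum_range_succ] at e1
    have e2 : a (M + 2 + j) = a (0 + 2 + j) := by rw [← hper (0 + 2 + j)]; ring_nf
    have e3 : a (M + j) = a (0 + j) := by rw [← hper (0 + j)]; ring_nf
    rw [e2, e3] at e1
    have e1 := Nat.add_right_cancel e1
    unfold time
    rw [e1]
    refine Finset.sum_congr rfl (fun i _ => ?_)
    ring_nf

section
variable [NeZero n]

lemma card_arc {a b : ZMod n} : (Finset.univ.filter (fun x => (b - a).val ≤ (x - a).val)).card =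
    n - (b - a).val := by
  rw [← Nat.card_Ico]
  refine Finset.card_bij (fun x _ => (x - a).val) ?_ ?_ ?_
  · intro x hx
    rw [Finset.mem_Ico]
    exact ⟨(Finset.mem_filter.1 hx).2, ZMod.val_lt _⟩
  · intro x _ y _ h
    exact sub_left_injective (ZMod.val_injective n h)
  · intro c hc
    rw [Finset.mem_Ico] at hc
    have : (a + (c : ℕ) - a).val = c := by
      rw [add_sub_cancel_left, ZMod.val_natCast_of_lt hc.2]
    exact ⟨a + c, Finset.mem_filter.2 ⟨Finset.mem_univ _, by rw [this]; exact hc.1⟩, this⟩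

/-- The number of edges of the closed walk `a` whose arc covers `x` does not depend on `x`, since
each vertex is the head of as many edges as it is the tail. -/
lemma card_cover_add_one {a : ℕ → ZMod n} {M : ℕ} (h0 : a M = a 0)
    (hne : ∀ j, a (j + 1) ≠ a j) (x : ZMod n) :
    ((Finset.range M).filter (fun j => (a (j + 1) - a j).val ≤ (x + 1 - a j).val)).card =
      ((Finset.range M).filter (fun j => (a (j + 1) - a j).val ≤ (x - a j).val)).card := by
  have h1 : ∀ j, (if (a (j + 1) - a j).val ≤ (x + 1 - a j).val then (1 : ℕ) else 0) +
      (if a j = x + 1 then 1 else 0) = (if (a (j + 1) - a j).val ≤ (x - a j).val then 1 else 0) +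
      (if a (j + 1) = x + 1 then 1 else 0) := by
    intro j
    have p0 := (val_pos_iff (a (j + 1) - a j)).2 (sub_ne_zero.2 (hne j))
    have p1 := ZMod.val_lt (a (j + 1) - a j)
    have p2 := ZMod.val_lt (x - a j)
    have p3 := ZMod.val_lt (x + 1 - a j)
    have p4 := val_cases (x + 1 - a j) ((x - a j).val + 1 : ℤ)
      (by push_cast; rw [ZMod.natCast_zmod_val]; ring) (by omega) (by omega)
    have p5 : a j = x + 1 ↔ (x + 1 - a j).val = 0 := by
      rw [ZMod.val_eq_zero, sub_eq_zero, eq_comm]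
    have p6 : a (j + 1) = x + 1 ↔ (a (j + 1) - a j).val = (x + 1 - a j).val :=
      ⟨fun h => by rw [h], fun h => sub_left_injective (ZMod.val_injective n h)⟩
    rw [if_congr p5 rfl rfl, if_congr p6 rfl rfl]
    split_ifs <;> omega
  have h2 := Finset.sum_congr (rfl : Finset.range M = _) (fun j _ => h1 j)
  rw [Finset.sum_add_distrib, Finset.sum_add_distrib] at h2
  have h3 := Finset.sum_range_succ' (fun j => if a j = x + 1 then (1 : ℕ) else 0) M
  rw [Finset.sum_range_succ, h0] at h3
  rw [Finset.card_filter, Finset.card_filter]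
  omega

/-- A closed walk along a `k`-star with `M = 2m + 1` edges, each of length `m`, makes exactly a half
turn: double counting shows that each vertex is covered by the arcs of `m` edges. -/
lemma sum_of_star {a : ℕ → ZMod n} {m : ℕ} (h0 : a (2 * m + 1) = a 0)
    (h1 : a (2 * m + 1 + 1) = a 1)
    (hne : ∀ j, a (j + 1) ≠ a j)
    (hd : ∀ j, (a (j + 2) - a j).val + (a j - a (j + 1)).val = (a (j + 2) - a (j + 1)).val)
    {Q : Finset (ZMod n)} (hQ : Q.card = 2 * m + 1)
    (hlen : ∀ j, (Q.filter (fun x => (a (j + 1) - a j).val ≤ (x - a j).val)).card = m) :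
    time a (2 * m + 1) = n := by
  set c : ZMod n → ℕ := fun x => ((Finset.range (2 * m + 1)).filter
    (fun j => (a (j + 1) - a j).val ≤ (x - a j).val)).card with hc
  have hconst : ∀ x, c x = c 0 := by
    intro x
    have : ∀ i : ℕ, c (i : ZMod n) = c 0 := by
      intro i
      induction i with
      | zero => rw [Nat.cast_zero]
      | succ i ih =>
        rw [← ih]
        push_cast
        exact card_cover_add_one h0 hne _
    rw [← this x.val, ZMod.natCast_zmod_val]
  have hdouble : ∀ S : Finset (ZMod n), ∑ x ∈ S, c x = ∑ j ∈ Finset.range (2 * m + 1),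
      (S.filter (fun x => (a (j + 1) - a j).val ≤ (x - a j).val)).card := by
    intro S
    simp only [hc, Finset.card_filter]
    exact Finset.sum_comm
  have e1 := hdouble Q
  simp only [hconst, hlen, Finset.sum_const, hQ, Finset.card_range, smul_eq_mul] at e1
  have e1 : c 0 = m := Nat.eq_of_mul_eq_mul_left (by omega) e1
  have e2 := hdouble Finset.univ
  simp only [hconst, card_arc, Finset.sum_const, Finset.card_univ, ZMod.card, smul_eq_mul, e1] at e2
  have hL : ∀ j, n - (a (j + 1) - a j).val = (a j - a (j + 1)).val := by
    intro j
    have := val_neg_add_val (hne j)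
    omega
  simp only [hL] at e2
  have e3 : ∀ j, (a (j + 2) - a j).val + ((a j - a (j + 1)).val +
      (a (j + 1) - a (j + 2)).val) = n := by
    intro j
    have := hd j
    have : (a (j + 2) - a (j + 1)).val + (a (j + 1) - a (j + 2)).val = n :=
      val_neg_add_val (hne (j + 1))
    omega
  have e4 := Finset.sum_congr (rfl : Finset.range (2 * m + 1) = _) (fun j _ => e3 j)
  have e5 := Finset.sum_range_succ' (fun j => (a j - a (j + 1)).val) (2 * m + 1)
  rw [Finset.sum_range_succ, h0, h1, ← e2] at e5
  rw [Finset.sum_add_distrib, Finset.sum_add_distrib, ← e2, Finset.sum_const, Finset.card_range,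
    smul_eq_mul] at e4
  simp only [Nat.add_assoc, Nat.reduceAdd] at e5 e4 ⊢
  have e6 : ∑ j ∈ Finset.range (2 * m + 1), (a (j + 1) - a (j + 2)).val = n * m := by
    have : (a 0 - a (0 + 1)).val = (a 0 - a 1).val := rfl
    omega
  rw [e6] at e4
  unfold time
  linarith

/-- The increments of every second vertex of a walk. -/
lemma even_vertex (a : ℕ → ZMod n) (i : ℕ) :
    a (2 * i) = a 0 + ((∑ j ∈ Finset.range i, (a (2 * j + 2) - a (2 * j)).val : ℕ) : ZMod n) := by
  induction i with
  | zero => simp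
  | succ i ih =>
    rw [Finset.sum_range_succ, Nat.cast_add, ZMod.natCast_zmod_val, ← add_assoc, ← ih]
    ring_nf

lemma sum_range_odd_split (d : ℕ → ℕ) (m : ℕ) : ∑ j ∈ Finset.range (2 * m), d j =
    ∑ j ∈ Finset.range m, d (2 * j) + ∑ j ∈ Finset.range m, d (2 * j + 1) := by
  induction m with
  | zero => simp
  | succ m ih =>
    rw [show 2 * (m + 1) = 2 * m + 1 + 1 by ring, Finset.sum_range_succ, Finset.sum_range_succ, ih,
      Finset.sum_range_succ, Finset.sum_range_succ]
    ring

/-- A closed walk that makes exactly a half turn has an odd number of edges: otherwise the vertices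
of even index and those of odd index would each go once around the circle. -/
lemma odd_of_half_turn {a : ℕ → ZMod n} {M : ℕ} (hM : 0 < M) (h0 : a M = a 0)
    (h2 : ∀ j, a (j + 2) ≠ a j) (ht : time a M = n) : ∃ m, M = 2 * m + 1 := by
  obtain ⟨q, hq | hq⟩ := Nat.even_or_odd' M
  · exfalso
    subst hq
    have h3 : ∀ j, 0 < (a (j + 2) - a j).val := fun j =>
      (val_pos_iff _).2 (sub_ne_zero.2 (h2 j))
    rw [time, sum_range_odd_split (fun j => (a (j + 2) - a j).val)] at ht
    have h4 := even_vertex a q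
    rw [h0, left_eq_add, ZMod.natCast_eq_zero_iff] at h4
    have hr : (Finset.range q).Nonempty := Finset.nonempty_range_iff.2 (by omega)
    have h5 := Nat.le_of_dvd (Finset.sum_pos (fun j _ => h3 (2 * j)) hr) h4
    have h6 := Finset.sum_pos (fun j _ => h3 (2 * j + 1)) hr
    omega
  · exact ⟨q, hq⟩

/-- In a closed walk with `2m + 1` edges that makes exactly a half turn, every second vertex taken
`2m + 1` times goes once around the circle.  Hence the vertices are distinct, and between the two
ends of the first edge there are `m` of them. -/
lemma star_of_half_turn {a : ℕ → ZMod n} {m : ℕ} (hp : ∀ j, a (j + (2 * m + 1)) = a j)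
    (h2 : ∀ j, a (j + 2) ≠ a j) (hm : 0 < m) (ht : time a (2 * m + 1) = n) :
    ((Finset.range (2 * m + 1)).image a).card = 2 * m + 1 ∧
    (((Finset.range (2 * m + 1)).image a).filter
      (fun x => (a 1 - a 0).val ≤ (x - a 0).val)).card = m := by
  set W : ℕ → ℕ := fun i => ∑ j ∈ Finset.range i, (a (2 * j + 2) - a (2 * j)).val with hW
  have hWs : StrictMono W := strictMono_nat_of_lt_succ (fun i => by
    have := (val_pos_iff _).2 (sub_ne_zero.2 (h2 (2 * i)))
    simp only [hW, Finset.sum_range_succ]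
    omega)
  have hWM : W (2 * m + 1) = n := by
    rw [← ht, time, Finset.sum_range_succ, sum_range_odd_split (fun j => (a (j + 2) - a j).val)]
    simp only [hW]
    rw [show 2 * m + 1 = m + 1 + m by ring, Finset.sum_range_add, Finset.sum_range_succ]
    have : ∑ x ∈ Finset.range m, (a (2 * (m + 1 + x) + 2) - a (2 * (m + 1 + x))).val =
        ∑ x ∈ Finset.range m, (a (2 * x + 1 + 2) - a (2 * x + 1)).val := by
      refine Finset.sum_congr rfl (fun x _ => ?_)
      rw [← hp (2 * x + 1 + 2), ← hp (2 * x + 1)]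
      ring_nf
    rw [this]
    ring
  have hev : ∀ i, a (2 * i) = a 0 + (W i : ZMod n) := even_vertex a
  have hval : ∀ i < 2 * m + 1, (a (2 * i) - a 0).val = W i := by
    intro i hi
    have := hWs hi
    rw [hev, add_sub_cancel_left, ZMod.val_natCast_of_lt (by omega)]
  have himg : (Finset.range (2 * m + 1)).image a =
      (Finset.range (2 * m + 1)).image (fun i => a (2 * i)) := by
    ext x
    simp only [Finset.mem_image, Finset.mem_range]
    constructor
    · rintro ⟨j, hj, rfl⟩
      obtain ⟨i, rfl | rfl⟩ := Nat.even_or_odd' j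
      · exact ⟨i, by omega, rfl⟩
      · refine ⟨i + m + 1, by omega, ?_⟩
        rw [← hp (2 * i + 1)]
        ring_nf
    · rintro ⟨j, hj, rfl⟩
      exact ⟨_, Nat.mod_lt _ (by omega), Function.Periodic.map_mod_nat hp (2 * j)⟩
  have hinj : Set.InjOn (fun i => a (2 * i)) (Finset.range (2 * m + 1)) := by
    intro i hi j hj h
    have hi := Finset.mem_range.1 (Finset.mem_coe.1 hi)
    have hj := Finset.mem_range.1 (Finset.mem_coe.1 hj)
    apply hWs.injective
    rw [← hval i hi, ← hval j hj]
    dsimp only at h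
    rw [h]
  rw [himg, Finset.card_image_of_injOn hinj, Finset.card_range]
  refine ⟨rfl, ?_⟩
  have h1 : a 1 = a (2 * (m + 1)) := by
    rw [← hp 1]
    ring_nf
  have : (((Finset.range (2 * m + 1)).image (fun i => a (2 * i))).filter
      (fun x => (a 1 - a 0).val ≤ (x - a 0).val)) =
      (Finset.Ico (m + 1) (2 * m + 1)).image (fun i => a (2 * i)) := by
    ext x
    simp only [Finset.mem_filter, Finset.mem_image, Finset.mem_range, Finset.mem_Ico]
    constructor
    · rintro ⟨⟨i, hi, rfl⟩, h⟩
      rw [h1, hval _ (by omega), hval i hi, hWs.le_iff_le] at h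
      exact ⟨i, ⟨h, hi⟩, rfl⟩
    · rintro ⟨i, ⟨h, hi⟩, rfl⟩
      refine ⟨⟨i, hi, rfl⟩, ?_⟩
      rw [h1, hval _ (by omega), hval i hi, hWs.le_iff_le]
      exact h
  rw [this, Finset.card_image_of_injOn (hinj.mono _), Nat.card_Ico]
  · omega
  · intro i hi
    have := Finset.mem_Ico.1 (Finset.mem_coe.1 hi)
    exact Finset.mem_coe.2 (Finset.mem_range.2 this.2)

end

/-! ### Labelling points on a circle -/

lemma ccw_rotate {u v w : ℂ} : CCW u v w ↔ CCW v w u := by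
  unfold CCW
  rw [show (v.re - u.re) * (w.im - u.im) - (v.im - u.im) * (w.re - u.re) =
    (w.re - v.re) * (u.im - v.im) - (w.im - v.im) * (u.re - v.re) by ring]

/-- The signed area of a triangle inscribed in a circle, as a product over its sides. -/
lemma area_eq_sin (c : ℂ) (r α β γ : ℝ) {u v w : ℂ}
    (hu : u.re = c.re + r * Real.cos α ∧ u.im = c.im + r * Real.sin α)
    (hv : v.re = c.re + r * Real.cos β ∧ v.im = c.im + r * Real.sin β)
    (hw : w.re = c.re + r * Real.cos γ ∧ w.im = c.im + r * Real.sin γ) :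
    (v.re - u.re) * (w.im - u.im) - (v.im - u.im) * (w.re - u.re) =
      4 * r ^ 2 * (Real.sin ((β - α) / 2) * Real.sin ((γ - β) / 2) *
        Real.sin ((γ - α) / 2)) := by
  obtain ⟨hu, hu'⟩ := hu
  obtain ⟨hv, hv'⟩ := hv
  obtain ⟨hw, hw'⟩ := hw
  set x := (β - α) / 2 with hx
  set y := (γ - β) / 2 with hy
  have e1 : (γ - α) / 2 = x + y := by rw [hx, hy]; ring
  have h1 : (v.re - u.re) * (w.im - u.im) - (v.im - u.im) * (w.re - u.re) =
      r ^ 2 * (Real.sin (β - α) + Real.sin (γ - β) - Real.sin (γ - α)) := by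
    rw [hu, hu', hv, hv', hw, hw', Real.sin_sub, Real.sin_sub, Real.sin_sub]
    ring
  rw [h1, e1, show β - α = 2 * x by rw [hx]; ring, show γ - β = 2 * y by rw [hy]; ring,
    show γ - α = 2 * (x + y) by rw [hx, hy]; ring, Real.sin_two_mul, Real.sin_two_mul,
    Real.sin_two_mul, Real.sin_add, Real.cos_add]
  have c1 := Real.sin_sq_add_cos_sq x
  have c2 := Real.sin_sq_add_cos_sq y
  linear_combination (-2 * r ^ 2 * Real.sin x * Real.cos x) * c2 -
    (2 * r ^ 2 * Real.sin y * Real.cos y) * c1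

/-- `p` lists the points of `V` in clockwise order: `p a, p b, p c` are in anti-clockwise order if and
only if one meets `b, a, c` in this order when counting up from `b`. -/
structure IsLabelling (V : Set ℂ) (p : ZMod n → ℂ) : Prop where
  inj : Function.Injective p
  range : Set.range p = V
  ccw : ∀ a b c, CCW (p a) (p b) (p c) ↔ 0 < (a - b).val ∧ (a - b).val < (c - b).val

/-- Sorting the points by decreasing argument labels them clockwise. -/
lemma exists_isLabelling [NeZero n] {V : Set ℂ} (hV : V.Finite) {c : ℂ} {r : ℝ} (hr : 0 < r)
    (hs : V ⊆ Metric.sphere c r) (hn : V.ncard = n) : ∃ p : ZMod n → ℂ, IsLabelling V p := by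
  classical
  have hcoord : ∀ z ∈ V, z.re = c.re + r * Real.cos (Complex.arg (z - c)) ∧
      z.im = c.im + r * Real.sin (Complex.arg (z - c)) := by
    intro z hz
    have hz : ‖z - c‖ = r := by simpa [dist_eq_norm] using hs hz
    rw [← hz, Complex.norm_mul_cos_arg, Complex.norm_mul_sin_arg]
    simp
  have hθ : Set.InjOn (fun z => -Complex.arg (z - c)) (hV.toFinset : Set ℂ) := by
    intro z hz w hw h
    have h : Complex.arg (z - c) = Complex.arg (w - c) := neg_injective h
    have h1 := hcoord z (by simpa using hz)
    have h2 := hcoord w (by simpa using hw)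
    rw [h] at h1
    exact Complex.ext (h1.1.trans h2.1.symm) (h1.2.trans h2.2.symm)
  have hA : (hV.toFinset.image (fun z => -Complex.arg (z - c))).card = n := by
    rw [Finset.card_image_of_injOn hθ, ← Set.ncard_eq_toFinset_card V hV, hn]
  set A := hV.toFinset.image (fun z => -Complex.arg (z - c)) with hAd
  let τ : ZMod n → ℝ := fun i => A.orderEmbOfFin hA ⟨i.val, ZMod.val_lt i⟩
  have hτ : ∀ i j, τ i < τ j ↔ i.val < j.val := fun i j => by
    simp only [τ, OrderEmbedding.lt_iff_lt, Fin.mk_lt_mk]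
  have hp : ∀ i, ∃ z ∈ V, Complex.arg (z - c) = -τ i := by
    intro i
    have : τ i ∈ A := Finset.orderEmbOfFin_mem A hA _
    rw [hAd, Finset.mem_image] at this
    obtain ⟨z, hz, h⟩ := this
    exact ⟨z, by simpa using hz, by rw [← h, neg_neg]⟩
  choose p hpV hpτ using hp
  have hτinj : ∀ i j, τ i = τ j → i = j := by
    intro i j h
    have h1 := hτ i j
    have h2 := hτ j i
    rw [h] at h1 h2
    simp only [lt_irrefl, false_iff] at h1 h2
    exact ZMod.val_injective n (by omega)
  have hinj : Function.Injective p := by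
    intro i j h
    apply hτinj
    rw [← neg_inj, ← hpτ, ← hpτ, h]
  refine ⟨p, hinj, ?_, ?_⟩
  · have h1 : Set.range p ⊆ V := by
      rintro _ ⟨i, rfl⟩
      exact hpV i
    refine Set.eq_of_subset_of_ncard_le h1 ?_ hV
    rw [hn, Set.ncard_range_of_injective hinj, Nat.card_zmod]
  · intro a b d
    have hrange : ∀ i, -Real.pi ≤ τ i ∧ τ i < Real.pi := by
      intro i
      have h1 := Complex.arg_le_pi (p i - c)
      have h2 := Complex.neg_pi_lt_arg (p i - c)
      rw [hpτ] at h1 h2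
      constructor <;> linarith
    have hpos : ∀ i j, 0 < Real.sin ((-τ i - -τ j) / 2) ↔ i.val < j.val := by
      intro i j
      have h1 := hrange i
      have h2 := hrange j
      rw [← hτ]
      constructor
      · intro h
        by_contra hc
        exact absurd h (not_lt.2 (Real.sin_nonpos_of_nonpos_of_neg_pi_le (by linarith)
          (by linarith)))
      · intro h
        exact Real.sin_pos_of_pos_of_lt_pi (by linarith) (by linarith)
    have hneg : ∀ i j, Real.sin ((-τ i - -τ j) / 2) < 0 ↔ j.val < i.val := by
      intro i j
      rw [← hpos j i, ← neg_pos, ← Real.sin_neg]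
      ring_nf
    have ha := hcoord _ (hpV a)
    have hb := hcoord _ (hpV b)
    have hd := hcoord _ (hpV d)
    rw [hpτ] at ha hb hd
    rw [CCW, area_eq_sin c r _ _ _ ha hb hd, mul_pos_iff_of_pos_left (by positivity), mul_pos_iff,
      mul_pos_iff, mul_neg_iff]
    simp only [hpos, hneg]
    have h1 := val_sub_cases a b
    have h2 := val_sub_cases d b
    have h3 := ZMod.val_lt a
    have h4 := ZMod.val_lt b
    have h5 := ZMod.val_lt d
    have h6 := ZMod.val_lt (a - b)
    have h7 := ZMod.val_lt (d - b)
    omega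

/-! ### The labelled polygon `P_n^k` -/

/-- The relation on labels given by a set of segments. -/
def segRel (p : ZMod n → ℂ) (D : Set (Sym2 ℂ)) (a b : ZMod n) : Prop := s(p a, p b) ∈ D

lemma IsLabelling.mem {V : Set ℂ} {p : ZMod n → ℂ} (hp : IsLabelling V p) (a : ZMod n) : p a ∈ V := by
  rw [← hp.range]
  exact ⟨a, rfl⟩

lemma IsP.exists_of_mem_subdivided {k : ℕ} {V : Set ℂ} {E : Set (ℂ × ℂ)}
    {D : Set (Sym2 ℂ)} {p : ZMod n → ℂ} (hP : IsP n k V E) (hp : IsLabelling V p)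
    (hD : IsDiagonalSet V E D) {e : ℂ × ℂ} (he : e ∈ subdividedEdges E D) :
    ∃ u v, e = (p u, p v) := by
  have : e.1 ∈ V ∧ e.2 ∈ V := by
    rcases he with he | he
    · exact hP.polygon.edges e he
    · have := hD _ _ he
      exact ⟨this.1, this.2.1⟩
  rw [← hp.range] at this
  obtain ⟨⟨u, hu⟩, ⟨v, hv⟩⟩ := this
  exact ⟨u, v, by rw [hu, hv]⟩

lemma IsLabelling.splits_iff {V : Set ℂ} {p : ZMod n → ℂ} (hp : IsLabelling V p) (u v w x : ZMod n) :
    Splits (p u) (p v) (p w) (p x) ↔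
      0 < (u - v).val ∧ (u - v).val < (x - v).val ∧ (x - v).val < (w - v).val := by
  rw [Splits, ← ccw_rotate (u := p x), ← ccw_rotate (u := p u), hp.ccw, hp.ccw]
  omega

section
variable [NeZero n] {k : ℕ} {V : Set ℂ} {E : Set (ℂ × ℂ)} {D : Set (Sym2 ℂ)} {p : ZMod n → ℂ}

lemma IsLabelling.edgeLength_eq (hp : IsLabelling V p) (Q : Finset (ZMod n)) {a b : ZMod n}
    (h : b ≠ a) : edgeLength (p '' Q) (p a) (p b) =
      (Q.filter (fun x => (b - a).val ≤ (x - a).val)).card := by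
  have h0 := (val_pos_iff _).2 (sub_ne_zero.2 h)
  have : {x ∈ p '' (Q : Set (ZMod n)) | CCW (p a) x (p b) ∨ x = p b} =
      p '' (Q.filter (fun x => (b - a).val ≤ (x - a).val) : Finset (ZMod n)) := by
    ext z
    constructor
    · rintro ⟨⟨x, hx, rfl⟩, h'⟩
      refine ⟨x, Finset.mem_coe.2 (Finset.mem_filter.2 ⟨hx, ?_⟩), rfl⟩
      rcases h' with h' | h'
      · rw [ccw_rotate, ccw_rotate, hp.ccw] at h'
        exact h'.2.le
      · rw [hp.inj h']
    · rintro ⟨x, hx, rfl⟩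
      obtain ⟨h1, h2⟩ := Finset.mem_filter.1 (Finset.mem_coe.1 hx)
      refine ⟨⟨x, h1, rfl⟩, ?_⟩
      by_cases e : x = b
      · exact Or.inr (by rw [e])
      · left
        rw [ccw_rotate, ccw_rotate, hp.ccw]
        have : (b - a).val ≠ (x - a).val := fun e' =>
          e (sub_left_injective (ZMod.val_injective n e')).symm
        omega
  rw [edgeLength, this, Set.ncard_image_of_injective _ hp.inj, Set.ncard_coe_finset]

lemma IsP.mem_edges_iff (hP : IsP n k V E) (hp : IsLabelling V p) (a b : ZMod n) :
    (p a, p b) ∈ E ↔ a = b + k := by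
  have hk := hP.pos
  have hn := hP.le
  have key : ∀ a b, (p a, p b) ∈ E → a = b + k := by
    intro a b h
    obtain ⟨w, hw, -⟩ := hP.polygon.outdegree _ (hp.mem b)
    have hc := hP.polygon.ccw _ _ _ h hw
    obtain ⟨c, rfl⟩ : ∃ c, p c = w := by
      have := (hP.polygon.edges _ hw).2
      rwa [← hp.range] at this
    rw [hp.ccw] at hc
    have hne : a ≠ b := fun e => by
      rw [e, sub_self, ZMod.val_zero] at hc
      omega
    have hl := hP.length _ h
    have hV : V = p '' (Finset.univ : Finset (ZMod n)) := by simp [hp.range]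
    rw [hV, hp.edgeLength_eq _ hne.symm, card_arc] at hl
    have := val_neg_add_val hne
    exact (natCast_val_eq (by omega)).1 (by omega)
  refine ⟨key a b, ?_⟩
  rintro rfl
  obtain ⟨w, hw, -⟩ := hP.polygon.outdegree _ (hp.mem (b + k))
  obtain ⟨c, rfl⟩ : ∃ c, p c = w := by
    have := (hP.polygon.edges _ hw).2
    rwa [← hp.range] at this
  rwa [← add_right_cancel (key _ _ hw)] at hw

lemma IsP.linkable_iff (hP : IsP n k V E) (hp : IsLabelling V p) (a b : ZMod n) :
    Linkable V E (p a) (p b) ↔ (k < (b - a).val ∧ (b - a).val + k < n) ∧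
      (k < (a - b).val ∧ (a - b).val + k < n) := by
  have hk := hP.pos
  have hn := hP.le
  have key : ∀ a b, (∃ x y, (x, p a) ∈ E ∧ (p a, y) ∈ E ∧ Splits x (p a) y (p b)) ↔
      k < (b - a).val ∧ (b - a).val + k < n := by
    intro a b
    have e1 : (a + k - a).val = k := (natCast_val_eq (by omega)).2 rfl
    have e2 : (a - k - a).val + k = n := val_sub_of_eq_add hk hn (by ring)
    constructor
    · rintro ⟨x, y, hx, hy, hs⟩
      obtain ⟨x, rfl⟩ : ∃ c, p c = x := by
        have := (hP.polygon.edges _ hx).1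
        rwa [← hp.range] at this
      obtain ⟨y, rfl⟩ : ∃ c, p c = y := by
        have := (hP.polygon.edges _ hy).2
        rwa [← hp.range] at this
      rw [hP.mem_edges_iff hp] at hx hy
      rw [hp.splits_iff, hx, eq_sub_of_add_eq hy.symm] at hs
      omega
    · rintro ⟨h1, h2⟩
      refine ⟨p (a + k), p (a - k), (hP.mem_edges_iff hp _ _).2 rfl,
        (hP.mem_edges_iff hp _ _).2 (by ring), ?_⟩
      rw [hp.splits_iff]
      omega
  rw [Linkable, key, key]
  simp only [hp.mem, true_and]

lemma IsP.isDiagRel (hP : IsP n k V E) (hp : IsLabelling V p) (hD : IsDiagonalSet V E D) :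
    IsDiagRel k (segRel p D) where
  symm := by
    intro v w h
    rw [segRel, Sym2.eq_swap]
    exact h
  lo := fun v w h => ((hP.linkable_iff hp _ _).1 (hD _ _ h)).1.1
  hi := fun v w h => ((hP.linkable_iff hp _ _).1 (hD _ _ h)).1.2

lemma IsP.mem_subdivided_iff (hP : IsP n k V E) (hp : IsLabelling V p) (u v : ZMod n) :
    (p u, p v) ∈ subdividedEdges E D ↔ Out k (segRel p D) u v := by
  rw [subdividedEdges, Set.mem_union, hP.mem_edges_iff hp, Out, or_comm]
  rfl

lemma IsP.isNext_iff (hP : IsP n k V E) (hp : IsLabelling V p) (hD : IsDiagonalSet V E D)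
    (u v : ZMod n) (f : ℂ × ℂ) : IsNext E D (p u, p v) f ↔
      ∃ w, f = (p v, p w) ∧ Next k (segRel p D) u v w := by
  have hk := hP.pos
  have hR := hP.isDiagRel hp hD
  constructor
  · rintro ⟨h1, h2, h3, h4, h5⟩
    obtain ⟨v', w, rfl⟩ := hP.exists_of_mem_subdivided hp hD h2
    have : v = v' := hp.inj h3
    subst this
    rw [hP.mem_subdivided_iff hp] at h1 h2
    dsimp only at h4 h5
    rw [hp.ccw] at h4
    refine ⟨w, rfl, h1, h2, h4.2, ?_⟩
    intro x hx hx'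
    refine h5 (p x) hx ?_
    rw [hp.splits_iff]
    exact ⟨h4.1, hx'⟩
  · rintro ⟨w, rfl, h⟩
    have h0 := h.out₁.val_in hP.le hR
    refine ⟨(hP.mem_subdivided_iff hp _ _).2 h.out₁, (hP.mem_subdivided_iff hp _ _).2 h.out₂, rfl,
      (hp.ccw _ _ _).2 ⟨by omega, h.lt⟩, ?_⟩
    intro x hx hs
    obtain ⟨x, rfl⟩ : ∃ c, p c = x := by
      have := (hD _ _ hx).2.1
      rwa [← hp.range] at this
    dsimp only at hs
    rw [hp.splits_iff] at hs
    exact h.not_split x hx hs.2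

lemma IsP.cycle_eq (hP : IsP n k V E) (hp : IsLabelling V p) (hD : IsDiagonalSet V E D)
    {a : ℕ → ZMod n} (ha : IsNextSeq k (segRel p D) a) :
    cycle E D (p (a 0), p (a 1)) = Set.range (fun j => (p (a j), p (a (j + 1)))) := by
  have hR := hP.isDiagRel hp hD
  ext f
  constructor
  · rintro (h : Relation.ReflTransGen (IsNext E D) (p (a 0), p (a 1)) f)
    induction h with
    | refl => exact ⟨0, rfl⟩
    | tail _ h ih =>
      obtain ⟨j, rfl⟩ := ih
      obtain ⟨w, rfl, hw⟩ := (hP.isNext_iff hp hD _ _ _).1 h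
      have := hw.unique hP.pos hP.le hR (ha j)
      subst this
      exact ⟨j + 1, rfl⟩
  · rintro ⟨j, rfl⟩
    induction j with
    | zero => exact Relation.ReflTransGen.refl
    | succ j ih =>
      exact Relation.ReflTransGen.tail ih ((hP.isNext_iff hp hD _ _ _).2 ⟨_, rfl, ha j⟩)

lemma IsP.verts_cycle_eq (hP : IsP n k V E) (hp : IsLabelling V p) (hD : IsDiagonalSet V E D)
    {a : ℕ → ZMod n} (ha : IsNextSeq k (segRel p D) a) :
    verts (cycle E D (p (a 0), p (a 1))) = p '' Set.range a := by
  rw [hP.cycle_eq hp hD ha]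
  ext z
  constructor
  · rintro ⟨_, ⟨j, rfl⟩, rfl | rfl⟩
    · exact ⟨_, ⟨j, rfl⟩, rfl⟩
    · exact ⟨_, ⟨j + 1, rfl⟩, rfl⟩
  · rintro ⟨_, ⟨j, rfl⟩, rfl⟩
    exact ⟨_, ⟨j, rfl⟩, Or.inl rfl⟩

/-! ### Stars are closed trajectories -/

/-- A walk along all edges of an `m`-star closes up after `2m + 1` steps, and the number of vertices
passed by each of its edges is `m`. -/
lemma IsKStar.closed_walk (hp : IsLabelling V p) {a : ℕ → ZMod n} {C : Set (ℂ × ℂ)}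
    (hC : C = Set.range (fun j => (p (a j), p (a (j + 1))))) (hV : verts C = p '' Set.range a)
    (hne : ∀ j, a (j + 1) ≠ a j) {m : ℕ} (hS : IsKStar m (verts C) C) :
    a (2 * m + 1) = a 0 ∧ a (2 * m + 1 + 1) = a 1 ∧ ∃ Q : Finset (ZMod n), Q.card = 2 * m + 1 ∧
      ∀ j, (Q.filter (fun x => (a (j + 1) - a j).val ≤ (x - a j).val)).card = m := by
  have hmem : ∀ j, (p (a j), p (a (j + 1))) ∈ C := fun j => by
    rw [hC]
    exact ⟨j, rfl⟩
  have hvm : ∀ j, p (a j) ∈ verts C := fun j => ⟨_, hmem j, Or.inl rfl⟩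
  have hfwd : ∀ i j, a i = a j → a (i + 1) = a (j + 1) := by
    intro i j h
    have h1 := hmem i
    rw [h] at h1
    exact hp.inj ((hS.polygon.outdegree _ (hvm j)).unique h1 (hmem j))
  have hbwd : ∀ i j, a (i + 1) = a (j + 1) → a i = a j := by
    intro i j h
    have h1 := hmem i
    rw [h] at h1
    exact hp.inj ((hS.polygon.indegree _ (hvm (j + 1))).unique h1 (hmem j))
  obtain ⟨Q, hQr⟩ : ∃ Q : Finset (ZMod n), (Q : Set (ZMod n)) = Set.range a :=
    ⟨(Set.toFinite (Set.range a)).toFinset, Set.Finite.coe_toFinset _⟩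
  rw [← hQr] at hV
  have hQ : Q.card = 2 * m + 1 := by
    rw [← hS.card, hV, Set.ncard_image_of_injective _ hp.inj, Set.ncard_coe_finset]
  have hPa : a (2 * m + 1) = a 0 := hQ ▸ eq_zero_of_card_range hQr hfwd hbwd
  refine ⟨hPa, hfwd _ _ hPa, Q, hQ, fun j => ?_⟩
  have hl := hS.length _ (hmem j)
  rw [hV, hp.edgeLength_eq Q (hne j)] at hl
  exact hl

/-- The walk along an `m`-star closes up after `2m + 1` steps and a half turn. -/
lemma IsP.time_of_star (hP : IsP n k V E) (hp : IsLabelling V p) (hD : IsDiagonalSet V E D)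
    {a : ℕ → ZMod n} (ha : IsNextSeq k (segRel p D) a) {m : ℕ}
    (hS : IsKStar m (verts (cycle E D (p (a 0), p (a 1)))) (cycle E D (p (a 0), p (a 1)))) :
    a (2 * m + 1) = a 0 ∧ a (2 * m + 1 + 1) = a 1 ∧ time a (2 * m + 1) = n := by
  have hR := hP.isDiagRel hp hD
  have hne : ∀ j, a (j + 1) ≠ a j := fun j => (ha j).out₁.ne hP.pos hP.le hR
  obtain ⟨h0, h1, Q, hQ, hlen⟩ := hS.closed_walk hp (hP.cycle_eq hp hD ha)
    (hP.verts_cycle_eq hp hD ha) hne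
  exact ⟨h0, h1, sum_of_star h0 h1 hne (fun j => ((ha j).val_sub hP.pos hP.le hR).2) hQ hlen⟩

/-- The cycles of a star decomposition give closed trajectories through all positions. -/
lemma IsP.covered (hP : IsP n k V E) (hp : IsLabelling V p) (hD : IsStarDecomposition V E D) :
    Covered k (segRel p D) := by
  have hR := hP.isDiagRel hp hD.1
  intro s v hv
  obtain ⟨u, w, i, hN, hi, hin, hs⟩ := hv.exists_next hP.pos hP.le hR
  obtain ⟨a, ha, rfl, rfl⟩ := hN.out₁.exists_seq hP.pos hP.le hR
  obtain ⟨m, hm⟩ := hD.2 _ ((hP.mem_subdivided_iff hp _ _).2 hN.out₁)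
  obtain ⟨-, h1, h2⟩ := hP.time_of_star hp hD.1 ha hm
  obtain ⟨f, hf, hfv, -⟩ := ha.exists_traj hP.pos hP.le hR h1 h2
  have hw := hN.unique hP.pos hP.le hR (ha 0)
  refine ⟨f, hf, ?_⟩
  rw [← hs]
  refine hfv 0 i (by simp [time]) ?_ hin
  rw [time_succ]
  rw [hw] at hi
  exact Nat.lt_add_left _ hi

/-! ### Closed trajectories are stars -/

/-- If all trajectories close up after a half turn, then all cycles are stars. -/
lemma IsP.isStarDecomposition (hP : IsP n k V E) (hp : IsLabelling V p)
    (hD : IsDiagonalSet V E D) (hc : Covered k (segRel p D)) : IsStarDecomposition V E D := by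
  classical
  have hR := hP.isDiagRel hp hD
  refine ⟨hD, ?_⟩
  intro e he
  obtain ⟨u, v, rfl⟩ := hP.exists_of_mem_subdivided hp hD he
  have hout := (hP.mem_subdivided_iff hp _ _).1 he
  obtain ⟨a, ha, rfl, rfl⟩ := hout.exists_seq hP.pos hP.le hR
  obtain ⟨f, hf, hfv⟩ := hc _ _ (hout.act hP.le hR)
  obtain ⟨M, hM0, hMt, hMa, hMa1⟩ := hf.exists_period hP.pos hP.le hR ha hfv
  have hper : Function.Periodic a M := ha.periodic hP.pos hP.le hR hMa hMa1
  have hne : ∀ j, a (j + 1) ≠ a j := fun j => (ha j).out₁.ne hP.pos hP.le hR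
  have hne2 : ∀ j, a (j + 2) ≠ a j := fun j h => by
    have := ((ha j).val_sub hP.pos hP.le hR).1
    rw [h, sub_self, ZMod.val_zero] at this
    omega
  obtain ⟨m, rfl⟩ := odd_of_half_turn hM0 hMa hne2 hMt
  have hm : 0 < m := by
    by_contra hm
    obtain rfl : m = 0 := by omega
    exact hne 0 hMa
  have hrange : ∀ j, (((Finset.range (2 * m + 1)).image (fun i => a (i + j)) : Finset (ZMod n)) :
      Set (ZMod n)) = Set.range a := by
    intro j
    ext x
    rw [Finset.mem_coe, Finset.mem_image]
    constructor
    · rintro ⟨i, -, rfl⟩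
      exact ⟨_, rfl⟩
    · rintro ⟨i, rfl⟩
      have hperj : Function.Periodic (fun i => a (i + j)) (2 * m + 1) := fun i => by
        have := hper (i + j)
        rw [add_right_comm] at this
        exact this
      have e : i + (2 * m + 1) * j = i + 2 * m * j + j := by ring
      have e' := hperj.map_mod_nat (i + 2 * m * j)
      have e'' := hper.nat_mul j i
      rw [Nat.cast_id, Nat.mul_comm] at e''
      rw [← e, e''] at e'
      exact ⟨_, Finset.mem_range.2 (Nat.mod_lt _ hM0), e'⟩
  have hstar : ∀ j, _ := fun j => star_of_half_turn (a := fun i => a (i + j)) (m := m)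
    (fun i => by
      have := hper (i + j)
      rw [add_right_comm] at this
      exact this)
    (fun i => by
      have := hne2 (i + j)
      rw [add_right_comm] at this
      exact this) hm
    ((time_shift hper j).trans hMt)
  have hcard : ((Finset.range (2 * m + 1)).image a).card = 2 * m + 1 := (hstar 0).1
  have hmod : ∀ i j, a i = a j → i ≡ j [MOD 2 * m + 1] := by
    intro i j h
    rw [← hper.map_mod_nat i, ← hper.map_mod_nat j] at h
    exact Finset.card_image_iff.1 (hcard.trans (Finset.card_range _).symm)
      (Finset.mem_coe.2 (Finset.mem_range.2 (Nat.mod_lt _ hM0)))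
      (Finset.mem_coe.2 (Finset.mem_range.2 (Nat.mod_lt _ hM0))) h
  have hof : ∀ i j, i ≡ j [MOD 2 * m + 1] → a i = a j := by
    intro i j h
    rw [← hper.map_mod_nat i, ← hper.map_mod_nat j, h]
  have hC := hP.cycle_eq hp hD ha
  have hV := hP.verts_cycle_eq hp hD ha
  refine ⟨m, hm, ⟨?_, ?_, ?_, ?_, ?_, ?_⟩, ?_, ?_⟩
  · rw [hV]
    exact Set.toFinite _
  · obtain ⟨c, r, hr, hs⟩ := hP.polygon.circle
    refine ⟨c, r, hr, ?_⟩
    rw [hV]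
    rintro _ ⟨x, -, rfl⟩
    exact hs (hp.mem x)
  · intro e he
    exact ⟨⟨e, he, Or.inl rfl⟩, ⟨e, he, Or.inr rfl⟩⟩
  · rw [hV, hC]
    rintro _ ⟨_, ⟨j, rfl⟩, rfl⟩
    refine ⟨p (a (j + 1)), ⟨j, rfl⟩, ?_⟩
    rintro w ⟨i, hi⟩
    obtain ⟨h1, rfl⟩ := Prod.mk.inj hi
    rw [hof _ _ ((hmod _ _ (hp.inj h1)).add_right 1)]
  · rw [hV, hC]
    rintro _ ⟨_, ⟨j, rfl⟩, rfl⟩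
    have hj : a (j + 2 * m + 1) = a j := hper j
    refine ⟨p (a (j + 2 * m)), ⟨j + 2 * m, by dsimp only; rw [hj]⟩, ?_⟩
    rintro w ⟨i, hi⟩
    obtain ⟨rfl, h1⟩ := Prod.mk.inj hi
    rw [hof _ _ (Nat.ModEq.add_right_cancel' 1 (hmod _ _ ((hp.inj h1).trans hj.symm)))]
  · rw [hC]
    rintro _ _ _ ⟨i, hi⟩ ⟨j, hj⟩
    obtain ⟨rfl, rfl⟩ := Prod.mk.inj hi
    obtain ⟨h1, rfl⟩ := Prod.mk.inj hj
    rw [hof _ _ ((hmod _ _ (hp.inj h1)).add_right 1), hp.ccw]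
    have := (ha i).out₁.val_in hP.le hR
    have := hP.pos
    exact ⟨by omega, (ha i).lt⟩
  · rw [hV, Set.ncard_image_of_injective _ hp.inj, ← hrange 0, Set.ncard_coe_finset]
    exact hcard
  · rw [hV, hC]
    rintro _ ⟨j, rfl⟩
    rw [← hrange j, hp.edgeLength_eq _ (hne j)]
    have := (hstar j).2
    simp only [zero_add, Nat.add_comm 1 j] at this
    exact this

end

end StarDecomp

theorem mainTheorem7 (n k : ℕ) (V : Set ℂ) (E : Set (ℂ × ℂ)) (hP : StarDecomp.IsP n k V E)
    (D : Set (Sym2 ℂ)) (hD : StarDecomp.IsMaximalStarDecomposition V E D) :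
    StarDecomp.IsKStarDecomposition k V E D := by
  open StarDecomp in
  have hk := hP.pos
  have hn := hP.le
  have : NeZero n := ⟨by omega⟩
  obtain ⟨c, r, hr, hs⟩ := hP.polygon.circle
  obtain ⟨p, hp⟩ := exists_isLabelling hP.polygon.finite hr hs hP.card
  obtain ⟨hstar, hmax⟩ := hD
  have hR := hP.isDiagRel hp hstar.1
  have hcov := hP.covered hp hstar
  have hone : ∀ f g s₁ s₂, IsTraj k (segRel p D) f → IsTraj k (segRel p D) g → f ≠ g →
      Cross f g s₁ → Cross f g s₂ → s₁ = s₂ := by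
    intro f g s₁ s₂ hf hg hfg h₁ h₂
    by_contra hne
    have hc := hcov.addChord₂ hf hg hfg h₁ h₂ hne
    set D' : Set (Sym2 ℂ) := D ∪ {s(p (f s₁), p (g s₁)), s(p (f s₂), p (g s₂))} with hD'
    have hrel : addChord (addChord (segRel p D) (f s₁) (g s₁)) (f s₂) (g s₂) = segRel p D' := by
      funext v w
      unfold addChord segRel
      simp only [hD', Set.mem_union, Set.mem_insert_iff, Set.mem_singleton_iff, Sym2.eq_iff,
        hp.inj.eq_iff, or_assoc]
    have hlink : ∀ s, Cross f g s → Linkable V E (p (f s)) (p (g s)) ∧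
        Linkable V E (p (g s)) (p (f s)) := by
      intro s h
      obtain ⟨h1, h2, h3, h4, -⟩ := h.chord hk hf hg
      exact ⟨(hP.linkable_iff hp _ _).2 ⟨⟨h1, h2⟩, h3, h4⟩,
        (hP.linkable_iff hp _ _).2 ⟨⟨h3, h4⟩, h1, h2⟩⟩
    have hdiag : IsDiagonalSet V E D' := by
      intro u v h
      simp only [hD', Set.mem_union, Set.mem_insert_iff, Set.mem_singleton_iff, Sym2.eq_iff] at h
      rcases h with h | (⟨rfl, rfl⟩ | ⟨rfl, rfl⟩) | (⟨rfl, rfl⟩ | ⟨rfl, rfl⟩)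
      · exact hstar.1 _ _ h
      · exact (hlink _ h₁).1
      · exact (hlink _ h₁).2
      · exact (hlink _ h₂).1
      · exact (hlink _ h₂).2
    rw [hrel] at hc
    refine hmax D' ⟨Set.subset_union_left, fun h => ?_⟩ (hP.isStarDecomposition hp hdiag hc)
    exact (h₁.chord hk hf hg).2.2.2.2 (h (Or.inr (Or.inl rfl)))
  refine ⟨hstar.1, fun e he => ?_⟩
  obtain ⟨m, hm⟩ := hstar.2 e he
  obtain ⟨u, v, rfl⟩ := hP.exists_of_mem_subdivided hp hstar.1 he
  obtain ⟨a, ha, rfl, rfl⟩ := ((hP.mem_subdivided_iff hp _ _).1 he).exists_seq hk hn hR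
  obtain ⟨-, h1, h2⟩ := hP.time_of_star hp hstar.1 ha hm
  obtain ⟨f, hf, -, hcard⟩ := ha.exists_traj hk hn hR h1 h2
  rw [hf.card_move hk hn hR hcov hone] at hcard
  obtain rfl : m = k := by omega
  exact hm
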